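/- **Setting.** Let $\mu:[0,1]^2\to\mathbb R$ be continuous, $d>0$, and let $D\subset\mathbb R^2$ be a nonempty closed set whose boundary $\partial D$ is the disjoint union of finitely many edge curves. Here an edge curve is a simple closed curve with a natural (unit speed) parametrization and a bounded second derivative, except at finitely many corner points; a corner point is a point at which the left and right limits of the velocity exist and the two directional tangents enclose an angle in $(0,\pi)\cup(\pi,2\pi)$. Put $m=\mu+d\,\mathbb 1_D$. For $n\ge 1$ and $1\le i,j\le n$ let $x_{ij}=\left(\frac{i-1/2}{n},\frac{j-1/2}{n}\right)$ and $Y_{ij}=m(x_{ij})+\varepsilon_{ij}$ with i.i.d. residuals $\varepsilon_{ij}$. Let $K:\mathbb R^2\to\mathbb R$ be Lipschitz continuous, nonnegative on $(-1,1)^2$ and zero elsewhere, with $K(0)>0$ and $\int K=1$. Let $L:\mathbb R\to\mathbb R$ be nonnegative, symmetric, zero outside $(-1,1)$ and twice differentiable with Lipschitz continuous $L'$ and $L''$, with $L'>0$ on $(-1,0)$, and such that $L''$ has only finitely many zeros in $(-1,1)$. Let $g>0$ be constant, and let $h_n>0$ with $h_n\to0$ and $n^{-1}h_n^{-1}\to0$.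 Let $l\in(0,\frac12)$. Write $K_h(u)=h^{-2}K(u/h)$ and $L_g(v)=g^{-1}L(v/g)$. **The TM-smoother.** For $x\in(0,1)^2$ let $J=\{(i,j):\|x-x_{ij}\|_\infty\le h_n\}$. For real $y$ let $s_{ij}(y)=(y-Y_{ij})^2$, and let $s_{(1)}(y)\le s_{(2)}(y)\le\dots$ be the ordered values of $s_{ij}(y)$, $(i,j)\in J$. Let $c$ be a minimizer of $y\mapsto\sum_{k=1}^{\#J-\lfloor l\,\#J\rfloor}s_{(k)}(y)$ (the $l$-trimmed LTS estimate). Put $$R=\{(i,j)\in J: s_{ij}(c)\le s_{(\lceil(1-l)\#J\rceil)}(c)\},\qquad \tilde H(y)=\frac1{n^2}\sum_{(i,j)\in R}K_{h_n}(x-x_{ij})\,L_g(y-Y_{ij}).$$ Let $x_{i_0j_0}$ be the design point closest to $x$ in the Euclidean norm, where ties are resolved in favour of the smaller index in each coordinate, and let $\mathcal N$ be the set of local maxima $y$ of $\tilde H$ with $\tilde H(y)>0$ such that $y<Y_{i_0j_0}$ if $\tilde H'(Y_{i_0j_0})<0$, and $y>Y_{i_0j_0}$ if $\tilde H'(Y_{i_0j_0})>0$.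 Then $m_{n,l}(x)$ is a point of the closure of $\mathcal N$ at minimal distance from $Y_{i_0j_0}$. Where the minimizers in this definition are not unique, $m_{n,l}(x)$ is any measurable selection; where $\mathcal N$ is empty, its value is arbitrary. **Theorem.** Let $P$ be a probability measure on $\mathbb R$ that has a density $f$ supported on a bounded or unbounded interval $\mathcal I\ni 0$, symmetric on $[-g,g]$, strictly decreasing on $(0,\infty)\cap\mathcal I$ and strictly increasing on $(-\infty,0)\cap\mathcal I$. Let $x_0\in(0,1)^2\setminus\partial D$. Then $m_{n,l}(x_0)$ is robust for large samples at $P$ in $x_0$. That is, for every $\varepsilon^*>0$ there are $\varepsilon>0$ and $N\in\mathbb N$ such that $$d_L\big((P)^{m_{n,l}(x_0)},(Q)^{m_{n,l}(x_0)}\big)\le\varepsilon^*$$ for all $n\ge N$ and all probability measures $Q$ on $\mathbb R$ with $d_L(P,Q)\le\varepsilon$. Here $(Q)^{m_{n,l}(x_0)}$ is the law of $m_{n,l}(x_0)$ when the residuals $\varepsilon_{ij}=Y_{ij}-m(x_{ij})$ are i.i.d. with law $Q$, and $d_L$ is the Lévy metric: $d_L(P,Q)=\min\{\varepsilon: F(y-\varepsilon)-\varepsilon\le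 G(y)\le F(y+\varepsilon)+\varepsilon\ \text{for all }y\in\mathbb R\}$, where $F$ and $G$ are the distribution functions of $P$ and $Q$. -/

import Mathlib

open MeasureTheory Filter Set
open scoped Topology

/-! ### The Lévy metric and large sample robustness -/

/-- The Lévy distance of two probability measures on the line. -/
noncomputable def levyDist (P Q : Measure ℝ) : ℝ :=
  sInf {ε : ℝ | ∀ y : ℝ, P.real (Iic (y - ε)) - ε ≤ Q.real (Iic y) ∧
    Q.real (Iic y) ≤ P.real (Iic (y + ε)) + ε}

/-- The plane with its Euclidean norm. -/
abbrev Plane : Type := EuclideanSpace ℝ (Fin 2)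

/-- The pixel positions `x_{ij} = ((i - 1/2)/n, (j - 1/2)/n)`, `1 ≤ i, j ≤ n`; the indices
`i - 1` and `j - 1` are the elements of `Fin n`. -/
noncomputable def designPoint (n : ℕ) (p : Fin n × Fin n) : Plane :=
  !₂[((p.1 : ℝ) + 1 / 2) / n, ((p.2 : ℝ) + 1 / 2) / n]

/-- The law of `T(Y)`, where `Y_{ij} = m(x_{ij}) + ε_{ij}` and the residuals `ε_{ij}` are i.i.d.
with law `Q`. -/
noncomputable def estimatorLaw (m : Plane → ℝ) (n : ℕ) (T : (Fin n × Fin n → ℝ) → ℝ)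
    (Q : Measure ℝ) : Measure ℝ :=
  (Measure.pi fun _ : Fin n × Fin n => Q).map fun ε => T fun p => m (designPoint n p) + ε p

/-- Large sample robustness at `P` of a sequence of estimators (of the value of the regression
function at a given point): `T n` is the estimator from `n × n` observations. -/
def IsRobustForLargeSamples (m : Plane → ℝ) (T : ∀ n : ℕ, (Fin n × Fin n → ℝ) → ℝ)
    (P : Measure ℝ) : Prop :=
  ∀ εstar : ℝ, 0 < εstar → ∃ ε : ℝ, 0 < ε ∧ ∃ N : ℕ,
    ∀ Q : Measure ℝ, IsProbabilityMeasure Q → levyDist P Q ≤ ε →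
      ∀ n : ℕ, N ≤ n → levyDist (estimatorLaw m n (T n) P) (estimatorLaw m n (T n) Q) ≤ εstar

/-! ### Edge curves and the class of images -/

/-- The curve `x` has a corner at the parameter `t`: the left and right limits `vl`, `vr` of the
velocity exist, and the two directional tangents, the rays from `x t` in the directions `-vl` and
`vr`, enclose an angle different from `0` and from `π`. (`InnerProductGeometry.angle` is the
unoriented angle, so oriented angles in `(0, π) ∪ (π, 2π)` are those with unoriented angle
in `(0, π)`.) -/
def HasCornerAt (x : ℝ → Plane) (t : ℝ) : Prop :=
  ∃ vl vr : Plane, Tendsto (deriv x) (𝓝[<] t) (𝓝 vl) ∧ Tendsto (deriv x) (𝓝[>] t) (𝓝 vr) ∧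
    InnerProductGeometry.angle (-vl) vr ∈ Ioo 0 Real.pi

/-- Edge curves: simple closed curves (closed curves are parametrized by periodic functions) with a
natural parametrization and a bounded second derivative, except at finitely many corner points. -/
def IsEdgeCurve (γ : Set Plane) : Prop :=
  ∃ (x : ℝ → Plane) (T : ℝ), 0 < T ∧ Continuous x ∧ Function.Periodic x T ∧
    InjOn x (Ico 0 T) ∧ γ = range x ∧
    ∃ (S : Set Plane) (C : ℝ), S.Finite ∧ S ⊆ γ ∧
      (∀ t, x t ∈ S → HasCornerAt x t) ∧
      ∀ t, x t ∉ S → DifferentiableAt ℝ x t ∧ ‖deriv x t‖ = 1 ∧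
        DifferentiableAt ℝ (deriv x) t ∧ ‖deriv (deriv x) t‖ ≤ C

/-- The closed unit square. -/
def unitSquare : Set Plane := {x | ∀ k, x k ∈ Icc (0 : ℝ) 1}

/-- The open unit square. -/
def openUnitSquare : Set Plane := {x | ∀ k, x k ∈ Ioo (0 : ℝ) 1}

open Classical in
/-- The regression function `μ + d 𝟙_D`. -/
noncomputable def regressionFunction (μ : Plane → ℝ) (d : ℝ) (D : Set Plane) (x : Plane) : ℝ :=
  μ x + if x ∈ D then d else 0

/-- The assumptions on the shape of the image `μ + d 𝟙_D`. -/
structure IsImageModel (μ : Plane → ℝ) (d : ℝ) (D : Set Plane) : Prop where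
  continuousOn : ContinuousOn μ unitSquare
  jump_pos : 0 < d
  nonempty : D.Nonempty
  isClosed : IsClosed D
  boundary : ∃ (k : ℕ) (γ : Fin k → Set Plane), (∀ i, IsEdgeCurve (γ i)) ∧
    (Pairwise fun i j => Disjoint (γ i) (γ j)) ∧ frontier D = ⋃ i, γ i

/-! ### Kernels, bandwidths and error laws -/

/-- The assumptions on the spatial kernel. -/
structure IsSpatialKernel (K : Plane → ℝ) : Prop where
  nonneg : ∀ u, (∀ k, u k ∈ Ioo (-1 : ℝ) 1) → 0 ≤ K u
  eq_zero : ∀ u, (¬ ∀ k, u k ∈ Ioo (-1 : ℝ) 1) → K u = 0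
  lipschitz : ∃ C, LipschitzWith C K
  pos_zero : 0 < K 0
  integral_eq_one : ∫ u, K u = 1

/-- The assumptions on the score kernel. -/
structure IsScoreKernel (L : ℝ → ℝ) : Prop where
  contDiff : ContDiff ℝ 2 L
  lipschitz_deriv : ∃ C, LipschitzWith C (deriv L)
  lipschitz_deriv_deriv : ∃ C, LipschitzWith C (deriv (deriv L))
  nonneg : ∀ v, 0 ≤ L v
  symmetric : ∀ v, L (-v) = L v
  eq_zero : ∀ v, v ∉ Ioo (-1 : ℝ) 1 → L v = 0
  deriv_pos : ∀ v ∈ Ioo (-1 : ℝ) 0, 0 < deriv L v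
  finite_zeros : {v ∈ Ioo (-1 : ℝ) 1 | deriv (deriv L) v = 0}.Finite

/-- The assumptions on the spatial bandwidths. -/
structure IsBandwidth (h : ℕ → ℝ) : Prop where
  pos : ∀ n, 0 < h n
  tendsto_zero : Tendsto h atTop (𝓝 0)
  tendsto_inv : Tendsto (fun n : ℕ => (n : ℝ)⁻¹ * (h n)⁻¹) atTop (𝓝 0)

/-- The law `P` has a density `f` which is supported on a (bounded or unbounded) interval `I`
containing `0`, symmetric on `[-g, g]`, strictly decreasing on `(0, ∞) ∩ I` and strictly increasing
on `(-∞, 0) ∩ I`. -/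
def IsUnimodalErrorLaw (g : ℝ) (P : Measure ℝ) : Prop :=
  ∃ (f : ℝ → ℝ) (I : Set ℝ), Measurable f ∧ (∀ y, 0 ≤ f y) ∧
    P = volume.withDensity (fun y => ENNReal.ofReal (f y)) ∧
    I.OrdConnected ∧ 0 ∈ I ∧ (∀ y, y ∉ I → f y = 0) ∧
    (∀ y ∈ Icc (-g) g, f (-y) = f y) ∧
    StrictAntiOn f (Ioi 0 ∩ I) ∧ StrictMonoOn f (Iio 0 ∩ I)

/-! ### The TM-smoother -/

/-- The indices of the observations in the window of radius `h` (in the maximum norm) around `x`. -/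
noncomputable def window (h : ℝ) (n : ℕ) (x : Plane) : Finset (Fin n × Fin n) :=
  Finset.univ.filter fun p => ∀ k, |x k - designPoint n p k| ≤ h

/-- The `k`-th smallest (`1 ≤ k ≤ #J`) of the numbers `s p`, `p ∈ J`, with multiplicities. -/
noncomputable def orderStat {ι : Type} (J : Finset ι) (s : ι → ℝ) (k : ℕ) : ℝ :=
  ((J.val.map s).sort (· ≤ ·)).getD (k - 1) 0

/-- The sum of the `#J - ⌊#J l⌋` smallest squared residuals `(y - Y_{ij})^2` in the window. -/
noncomputable def trimmedSquares (h l : ℝ) (n : ℕ) (x : Plane) (Y : Fin n × Fin n → ℝ)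
    (y : ℝ) : ℝ :=
  ∑ k ∈ Finset.Icc 1 ((window h n x).card - ⌊((window h n x).card : ℝ) * l⌋₊),
    orderStat (window h n x) (fun p => (y - Y p) ^ 2) k

/-- `c` is a value of the `l`-trimmed least-trimmed-squares estimator. -/
def IsLTSValue (h l : ℝ) (n : ℕ) (x : Plane) (Y : Fin n × Fin n → ℝ) (c : ℝ) : Prop :=
  ∀ y, trimmedSquares h l n x Y c ≤ trimmedSquares h l n x Y y

/-- The indices of the observations in the window that are retained by the trimming procedure based
on the value `c` of the least-trimmed-squares estimator. -/
noncomputable def retained (h l : ℝ) (n : ℕ) (x : Plane) (Y : Fin n × Fin n → ℝ) (c : ℝ) :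
    Finset (Fin n × Fin n) :=
  (window h n x).filter fun p => (c - Y p) ^ 2 ≤
    orderStat (window h n x) (fun q => (c - Y q) ^ 2) ⌈(1 - l) * ((window h n x).card : ℝ)⌉₊

/-- The score function `n⁻² ∑_{(i,j) ∈ R} K_h(x - x_{ij}) L_g(y - Y_{ij})`, where
`K_h(u) = h⁻² K(u/h)` and `L_g(v) = g⁻¹ L(v/g)`. -/
noncomputable def scoreFunction (K : Plane → ℝ) (L : ℝ → ℝ) (g h : ℝ) (n : ℕ) (x : Plane)
    (R : Finset (Fin n × Fin n)) (Y : Fin n × Fin n → ℝ) (y : ℝ) : ℝ :=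
  1 / (n : ℝ) ^ 2 * ∑ p ∈ R,
    (1 / h ^ 2 * K (h⁻¹ • (x - designPoint n p))) * (1 / g * L ((y - Y p) / g))

/-- The index of the pixel position closest to `x`; of two equally close neighbours the one with the
smaller index is taken, in each coordinate. -/
def IsCentre (n : ℕ) (x : Plane) (p : Fin n × Fin n) : Prop :=
  (∀ q, ‖x - designPoint n p‖ ≤ ‖x - designPoint n q‖) ∧
    ∀ q, ‖x - designPoint n q‖ = ‖x - designPoint n p‖ → p.1 ≤ q.1 ∧ p.2 ≤ q.2

/-- The admissible local maxima of the score function `H` for the starting value `y₀`. -/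
def admissibleModes (H : ℝ → ℝ) (y₀ : ℝ) : Set ℝ :=
  {y | IsLocalMax H y ∧ 0 < H y ∧ (deriv H y₀ < 0 → y < y₀) ∧ (0 < deriv H y₀ → y₀ < y)}

/-- `v` is a value of the TM-smoother at `x` for the observations `Y`: with some value `c` of the
least-trimmed-squares estimator, it is a point of the closure of the set of admissible modes with
minimal distance from the observation in the centre of the window. -/
def IsTMValue (K : Plane → ℝ) (L : ℝ → ℝ) (g h l : ℝ) (n : ℕ) (x : Plane)
    (Y : Fin n × Fin n → ℝ) (v : ℝ) : Prop :=
  ∃ (p₀ : Fin n × Fin n) (c : ℝ), IsCentre n x p₀ ∧ IsLTSValue h l n x Y c ∧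
    v ∈ closure (admissibleModes (scoreFunction K L g h n x (retained h l n x Y c) Y) (Y p₀)) ∧
    ∀ w ∈ closure (admissibleModes (scoreFunction K L g h n x (retained h l n x Y c) Y) (Y p₀)),
      |v - Y p₀| ≤ |w - Y p₀|

/-- `T` is a version of the TM-smoother at `x`: it selects one of the values (the minimizers in the
definition need not be unique), wherever there is one. -/
def IsTMSmoother (K : Plane → ℝ) (L : ℝ → ℝ) (g h l : ℝ) (n : ℕ) (x : Plane)
    (T : (Fin n × Fin n → ℝ) → ℝ) : Prop :=
  ∀ Y, (∃ v, IsTMValue K L g h l n x Y v) → IsTMValue K L g h l n x Y (T Y)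

/-! Large sample robustness follows from a uniform concentration statement: for all `Q` in a small
Lévy ball around `P`, and for `P` itself, the smoother lies near `m(x₀)` with high probability once
`n` is large. Two laws concentrated near the same point are Lévy close, so no continuity of the
estimator in `Q` is needed.

Population picture. An LTS value is the mean `c` of the observations closest to it, hence in the
limit the centre of an interval `[c - r, c + r]` of `P`-mass `1 - l` whose centre of mass is `c`.
Unimodality and symmetry on `[-g, g]` force either `c = 0` or that the interval contains `[-g, g]`
(`eq_zero_or_subset_of_integral_eq_zero`). In both cases symmetrizing around a point `y` of the
support and of the interval shows that the truncated density smoothed by `L_g` strictly increases at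
`y` to the left of `0` and strictly decreases to the right (`integral_kernel_pos`). Both facts are
rigidity statements: an integral against an odd kernel with the wrong sign would make the density
symmetric about a point other than its mode.

Stability. Since `l < 1/2`, the trimmed mean and its radius stay in a compact box
(`IsTrimmedMean.bounds`). Compactness turns the strict signs into a gap valid for approximate fixed
points (`exists_gap`), and integration by parts transfers it to every sample whose uniform and
kernel-weighted empirical distribution functions are uniformly close to that of `P`
(`exists_delta`).

Probability. A finite net of quantiles and Chebyshev's inequality give this closeness uniformly over
the Lévy ball, even after small perturbations of the observations
(`exists_measure_not_cdfClose_le`). These perturbations absorb the oscillation of `m` on the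
shrinking window, since `m` is continuous at `x₀`. Chebyshev's bound tends to zero because the
number of pixels in the window tends to infinity.

Conclusion. With the correct signs of the derivative, a mode next to a starting value in the central
range is within `3 * η` of `m(x₀)` (`admissibleModes_near`). -/

/-! ### Order statistics and least trimmed squares -/

/-- The order statistics are the values along an enumeration of the index set. -/
theorem exists_enumeration_orderStat {ι : Type} (J : Finset ι) (s : ι → ℝ) :
    ∃ e : Fin J.card ≃ J, Monotone (fun i => s (e i)) ∧
      ∀ i : Fin J.card, orderStat J s (i + 1) = s (e i) := by
  classical
  let e₀ : Fin J.card ≃ J := J.equivFin.symm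
  let σ := Tuple.sort (fun i => s (e₀ i))
  have hmono : Monotone (fun i => s ((σ.trans e₀) i)) := Tuple.monotone_sort (fun i => s (e₀ i))
  refine ⟨σ.trans e₀, hmono, fun i => ?_⟩
  have hlist : (J.val.map s).sort (· ≤ ·) = List.ofFn (fun i => s ((σ.trans e₀) i)) := by
    apply List.Perm.eq_of_pairwise' (r := (· ≤ ·))
    · exact Multiset.pairwise_sort _ _
    · exact List.pairwise_ofFn.2 fun i j hij => hmono hij.le
    · rw [← Multiset.coe_eq_coe, Multiset.sort_eq]
      have h1 : ((List.ofFn (fun i => s ((σ.trans e₀) i)) : List ℝ) : Multiset ℝ)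
          = (Finset.univ : Finset (Fin J.card)).val.map (fun i => s ((σ.trans e₀) i)) := by
        simp [List.ofFn_eq_map, Fin.univ_def]
      rw [h1]
      have h2 : (Finset.univ : Finset J).val.map (fun p : J => s p) = J.val.map s := by
        have := J.attach_map_val
        conv_rhs => rw [← this]
        simp [Finset.univ_eq_attach]
      rw [← h2, ← Finset.map_univ_equiv (σ.trans e₀)]
      simp [Function.comp_def]
  unfold orderStat
  rw [hlist]
  simp

/-- The sum of the `k` smallest values is the sum over a set of `k` indices, which is separated
from its complement by the `k`-th order statistic. -/
theorem exists_subset_sum_orderStat {ι : Type} (J : Finset ι) (s : ι → ℝ) {k : ℕ} (hk : 1 ≤ k)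
    (hkJ : k ≤ J.card) :
    ∃ S ⊆ J, S.card = k ∧ ∑ i ∈ Finset.Icc 1 k, orderStat J s i = ∑ p ∈ S, s p ∧
      (∀ p ∈ S, s p ≤ orderStat J s k) ∧ (∀ p ∈ J, p ∉ S → orderStat J s k ≤ s p) ∧
      ∃ p ∈ J, s p = orderStat J s k := by
  classical
  obtain ⟨e, hmono, he⟩ := exists_enumeration_orderStat J s
  let emb : Fin k ↪ ι := ⟨fun i => (e (Fin.castLE hkJ i) : ι), fun i j hij => by
    simpa using Subtype.ext hij⟩
  have hlast : orderStat J s k = s (e ⟨k - 1, by omega⟩) := by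
    rw [← he]; congr 1; simp; omega
  refine ⟨Finset.univ.map emb, ?_, by simp, ?_, ?_, ?_, ⟨_, (e ⟨k - 1, by omega⟩).2, hlast.symm⟩⟩
  · intro p hp
    obtain ⟨i, -, rfl⟩ := Finset.mem_map.1 hp
    exact (e _).2
  · rw [Finset.sum_map]
    have : ∀ i : Fin k, s (emb i) = orderStat J s (i + 1) := fun i => by
      rw [show s (emb i) = s (e (Fin.castLE hkJ i)) from rfl, ← he]; rfl
    simp_rw [this]
    rw [Fin.sum_univ_eq_sum_range (fun i => orderStat J s (i + 1)), Finset.range_eq_Ico,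
      Finset.sum_Ico_add' (fun i => orderStat J s i) 0 k 1]
    rfl
  · intro p hp
    obtain ⟨i, -, rfl⟩ := Finset.mem_map.1 hp
    rw [hlast]
    apply hmono
    have := i.2
    simp only [Fin.le_def, Fin.val_castLE]
    omega
  · intro p hp hpS
    obtain ⟨i, hi⟩ := e.surjective ⟨p, hp⟩
    have hi' : (e i : ι) = p := by rw [hi]
    rw [hlast, ← hi']
    apply hmono
    rw [Fin.le_def]
    by_contra hlt
    simp only [not_le] at hlt
    apply hpS
    refine Finset.mem_map.2 ⟨⟨i, by omega⟩, Finset.mem_univ _, ?_⟩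
    rw [← hi']
    rfl

/-- The sum of the `k` smallest values is at most the sum over any `k` indices. -/
theorem sum_orderStat_le {ι : Type} (J : Finset ι) (s : ι → ℝ) {k : ℕ} (hk : 1 ≤ k)
    {S : Finset ι} (hS : S ⊆ J) (hSk : S.card = k) :
    ∑ i ∈ Finset.Icc 1 k, orderStat J s i ≤ ∑ p ∈ S, s p := by
  classical
  obtain ⟨S₀, hS₀J, hS₀k, hsum, hle, hge, -⟩ :=
    exists_subset_sum_orderStat J s hk (hSk ▸ Finset.card_le_card hS)
  rw [hsum, ← Finset.sum_sdiff_le_sum_sdiff]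
  have hcard : (S₀ \ S).card = (S \ S₀).card := Finset.card_sdiff_comm (hS₀k.trans hSk.symm)
  calc ∑ p ∈ S₀ \ S, s p ≤ (S₀ \ S).card • orderStat J s k :=
        Finset.sum_le_card_nsmul _ _ _ fun p hp => hle p (Finset.mem_sdiff.1 hp).1
    _ = (S \ S₀).card • orderStat J s k := by rw [hcard]
    _ ≤ ∑ p ∈ S \ S₀, s p :=
        Finset.card_nsmul_le_sum _ _ _ fun p hp =>
          hge p (hS (Finset.mem_sdiff.1 hp).1) (Finset.mem_sdiff.1 hp).2

/-- The trimmed sum has `#J - ⌊#J * l⌋` terms, whereas the retention threshold has index `⌈(1 - l) *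
#J⌉`. Their agreement makes the threshold the largest residual entering the LTS sum. -/
theorem ceil_one_sub_mul_eq {l : ℝ} (hl : l ∈ Ioo (0 : ℝ) 1) (N : ℕ) :
    ⌈(1 - l) * (N : ℝ)⌉₊ = N - ⌊(N : ℝ) * l⌋₊ := by
  have h0 : 0 ≤ (N : ℝ) * l := mul_nonneg N.cast_nonneg hl.1.le
  have h1 : ⌊(N : ℝ) * l⌋₊ ≤ N := by
    apply Nat.floor_le_of_le
    nlinarith [N.cast_nonneg (α := ℝ), hl.2]
  have h2 := Nat.floor_le h0
  have h3 := Nat.lt_floor_add_one ((N : ℝ) * l)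
  rcases Nat.eq_zero_or_pos (N - ⌊(N : ℝ) * l⌋₊) with h4 | h4
  · have : (N : ℝ) ≤ ⌊(N : ℝ) * l⌋₊ := by exact_mod_cast Nat.sub_eq_zero_iff_le.1 h4
    rw [h4, Nat.ceil_eq_zero]
    nlinarith [N.cast_nonneg (α := ℝ)]
  · rw [Nat.ceil_eq_iff h4.ne', Nat.cast_sub (by omega), Nat.cast_sub h1]
    push_cast
    constructor <;> linarith

/-- The cross term vanishes because the deviations from `a` sum to zero. Thus the mean is the only
minimizer of the squared residuals over a fixed nonempty index set. -/
theorem sum_sq_sub_eq {ι : Type} (S : Finset ι) (Y : ι → ℝ) {a : ℝ}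
    (ha : ∑ p ∈ S, (Y p - a) = 0) (y : ℝ) :
    ∑ p ∈ S, (y - Y p) ^ 2 = ∑ p ∈ S, (a - Y p) ^ 2 + S.card * (y - a) ^ 2 := by
  have h : ∀ p, (y - Y p) ^ 2 = (a - Y p) ^ 2 + (y - a) ^ 2 - 2 * (y - a) * (Y p - a) := fun p => by
    ring
  simp_rw [h]
  rw [Finset.sum_sub_distrib, Finset.sum_add_distrib, ← Finset.mul_sum, ha]
  simp

theorem sum_sub_mean_eq_zero {ι : Type} (S : Finset ι) (Y : ι → ℝ) (hS : S.Nonempty) :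
    ∑ p ∈ S, (Y p - (∑ q ∈ S, Y q) / S.card) = 0 := by
  have : (S.card : ℝ) ≠ 0 := by exact_mod_cast hS.card_pos.ne'
  rw [Finset.sum_sub_distrib]
  simp [mul_div_cancel₀ _ this]

section LTS

variable {h l : ℝ} {n : ℕ} {x : Plane} (Y : Fin n × Fin n → ℝ)

theorem retained_card_pos (hl : l ∈ Ioo (0 : ℝ) (1 / 2)) (hJ : (window h n x).Nonempty) :
    1 ≤ (window h n x).card - ⌊((window h n x).card : ℝ) * l⌋₊ := by
  rw [← ceil_one_sub_mul_eq ⟨hl.1, by linarith [hl.2]⟩, Nat.one_le_ceil_iff]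
  have : (0 : ℝ) < (window h n x).card := by exact_mod_cast hJ.card_pos
  have := hl.2
  apply mul_pos <;> linarith

/-- For a fixed index set the best value is its mean, so minimizing over all reals reduces to
comparing the finitely many means of `k`-element subsets of the window. -/
theorem exists_isLTSValue (hl : l ∈ Ioo (0 : ℝ) (1 / 2)) (hJ : (window h n x).Nonempty) :
    ∃ c, IsLTSValue h l n x Y c := by
  classical
  set J := window h n x with hJdef
  set k := J.card - ⌊(J.card : ℝ) * l⌋₊ with hk
  have hk1 : 1 ≤ k := retained_card_pos hl hJ
  let mean : Finset (Fin n × Fin n) → ℝ := fun S => (∑ q ∈ S, Y q) / S.card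
  obtain ⟨S, hS, hmin⟩ := Finset.exists_min_image (Finset.powersetCard k J)
    (fun S => ∑ p ∈ S, (mean S - Y p) ^ 2) (Finset.powersetCard_nonempty.2 (Nat.sub_le _ _))
  rw [Finset.mem_powersetCard] at hS
  refine ⟨mean S, fun y => ?_⟩
  obtain ⟨S', hS', hS'k, hsum, -⟩ :=
    exists_subset_sum_orderStat J (fun p => (y - Y p) ^ 2) hk1 (Nat.sub_le _ _)
  have hne : S'.Nonempty := Finset.card_pos.1 (by omega)
  calc trimmedSquares h l n x Y (mean S) ≤ ∑ p ∈ S, (mean S - Y p) ^ 2 :=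
        sum_orderStat_le J (fun p => (mean S - Y p) ^ 2) hk1 hS.1 hS.2
    _ ≤ ∑ p ∈ S', (mean S' - Y p) ^ 2 := hmin S' (Finset.mem_powersetCard.2 ⟨hS', hS'k⟩)
    _ ≤ ∑ p ∈ S', (y - Y p) ^ 2 := by
        rw [sum_sq_sub_eq S' Y (sum_sub_mean_eq_zero S' Y hne) y]
        have : 0 ≤ (S'.card : ℝ) * (y - (∑ q ∈ S', Y q) / S'.card) ^ 2 := by positivity
        exact le_add_of_nonneg_right this
    _ = trimmedSquares h l n x Y y := hsum.symm

/-- A value of the least-trimmed-squares estimator is the mean of the observations of smallest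
residuals. -/
theorem IsLTSValue.exists_mean (hl : l ∈ Ioo (0 : ℝ) (1 / 2)) (hJ : (window h n x).Nonempty)
    {c : ℝ} (hc : IsLTSValue h l n x Y c) :
    ∃ ρ : ℝ, 0 ≤ ρ ∧ retained h l n x Y c = (window h n x).filter (fun p => |Y p - c| ≤ ρ) ∧
      ∃ S ⊆ window h n x, S.card = (window h n x).card - ⌊((window h n x).card : ℝ) * l⌋₊ ∧
        (∀ p ∈ S, |Y p - c| ≤ ρ) ∧ (∀ p ∈ window h n x, p ∉ S → ρ ≤ |Y p - c|) ∧
        ∑ p ∈ S, (Y p - c) = 0 := by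
  classical
  set J := window h n x with hJdef
  have hk1 : 1 ≤ J.card - ⌊(J.card : ℝ) * l⌋₊ := retained_card_pos hl hJ
  obtain ⟨S, hSJ, hSk, hsum, hle, hge, p₀, hp₀, hp₀'⟩ :=
    exists_subset_sum_orderStat J (fun p => (c - Y p) ^ 2) hk1 (Nat.sub_le _ _)
  have hsq : ∀ p, (c - Y p) ^ 2 ≤ (c - Y p₀) ^ 2 ↔ |Y p - c| ≤ |Y p₀ - c| := fun p => by
    rw [sq_le_sq, abs_sub_comm c, abs_sub_comm c]
  have hsq' : ∀ p, (c - Y p₀) ^ 2 ≤ (c - Y p) ^ 2 ↔ |Y p₀ - c| ≤ |Y p - c| := fun p => by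
    rw [sq_le_sq, abs_sub_comm c, abs_sub_comm c]
  rw [← hp₀'] at hle hge
  refine ⟨|Y p₀ - c|, abs_nonneg _, ?_, S, hSJ, hSk, fun p hp => (hsq p).1 (hle p hp),
    fun p hp hpS => (hsq' p).1 (hge p hp hpS), ?_⟩
  · unfold retained
    rw [ceil_one_sub_mul_eq ⟨hl.1, by linarith [hl.2]⟩, ← hJdef, ← hp₀']
    exact Finset.filter_congr fun p _ => hsq p
  · have hne : S.Nonempty := Finset.card_pos.1 (by omega)
    set a := (∑ q ∈ S, Y q) / S.card with ha
    have hmean := sum_sub_mean_eq_zero S Y hne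
    -- Optimality of `c` is tested against the mean `a` of the same set `S`, whose sum bounds the
    -- trimmed sum at `a`. By the identity for squared deviations this forces `c = a`.
    have h1 : ∑ p ∈ S, (c - Y p) ^ 2 ≤ ∑ p ∈ S, (a - Y p) ^ 2 := by
      rw [← hsum]
      exact (hc a).trans (sum_orderStat_le J (fun p => (a - Y p) ^ 2) hk1 hSJ hSk)
    rw [sum_sq_sub_eq S Y hmean c] at h1
    have h2 : (0 : ℝ) < S.card := by exact_mod_cast hne.card_pos
    have h3 : (c - a) ^ 2 ≤ 0 := by
      by_contra hcon
      have := mul_pos h2 (not_le.1 hcon)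
      linarith
    have h4 : c = a := by nlinarith [pow_eq_zero_iff (two_ne_zero) |>.1 (le_antisymm h3 (sq_nonneg _))]
    rw [h4]
    exact hmean

end LTS

/-! ### Integrals under uniformly close distribution functions -/

/-- Integration by parts against a finite measure on an interval. -/
theorem setIntegral_Icc_eq_sub_integral_measure {ν : Measure ℝ} [IsFiniteMeasure ν] {φ : ℝ → ℝ}
    (hφ : ContDiff ℝ 1 φ) {a b : ℝ} :
    ∫ z in Icc a b, φ z ∂ν =
      φ b * ν.real (Icc a b) - ∫ t in Ioc a b, deriv φ t * ν.real (Icc a t) := by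
  have hd : Continuous (deriv φ) := hφ.continuous_deriv le_rfl
  -- Fubini on the triangle `z ≤ t`: integrating `deriv φ t` over `t` first gives `φ b - φ z`, over
  -- `z` first gives `deriv φ t` times the mass of `[a, t]`.
  have hF : Integrable (Function.uncurry fun z t => ({q : ℝ × ℝ | q.1 ≤ q.2}.indicator
      (fun q => deriv φ q.2) (z, t) : ℝ)) ((ν.restrict (Icc a b)).prod (volume.restrict (Ioc a b))) := by
    have h1 : Integrable (fun q : ℝ × ℝ => deriv φ q.2)
        ((ν.restrict (Icc a b)).prod (volume.restrict (Ioc a b))) := by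
      have h2 : Integrable (deriv φ) (volume.restrict (Ioc a b)) :=
        (hd.integrableOn_Icc).mono_set Ioc_subset_Icc_self
      exact h2.comp_snd _
    exact h1.indicator (measurableSet_le measurable_fst measurable_snd)
  have hswap := integral_integral_swap hF
  have hL : ∀ z ∈ Icc a b, ∫ t in Ioc a b, ({q : ℝ × ℝ | q.1 ≤ q.2}.indicator
      (fun q => deriv φ q.2) (z, t) : ℝ) = φ b - φ z := by
    intro z hz
    have h1 : ∀ t, ({q : ℝ × ℝ | q.1 ≤ q.2}.indicator (fun q => deriv φ q.2) (z, t) : ℝ)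
        = (Ici z).indicator (deriv φ) t := fun t => by
      simp [indicator]
    simp_rw [h1]
    rw [integral_indicator measurableSet_Ici, Measure.restrict_restrict measurableSet_Ici]
    have h2 : ∫ t in Ici z ∩ Ioc a b, deriv φ t = ∫ t in Ioc z b, deriv φ t := by
      apply setIntegral_congr_set
      have : (Ioc z b : Set ℝ) ⊆ Ici z ∩ Ioc a b := fun t ht =>
        ⟨ht.1.le, lt_of_le_of_lt hz.1 ht.1, ht.2⟩
      have h3 : Ici z ∩ Ioc a b ⊆ Icc z b := fun t ht => ⟨ht.1, ht.2.2⟩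
      exact (h3.eventuallyLE.trans Ioc_ae_eq_Icc.symm.le).antisymm this.eventuallyLE
    rw [h2, ← intervalIntegral.integral_of_le hz.2]
    exact intervalIntegral.integral_deriv_eq_sub
      (fun t _ => (hφ.differentiable one_ne_zero) t) (hd.intervalIntegrable _ _)
  have hR : ∀ t ∈ Ioc a b, ∫ z in Icc a b, ({q : ℝ × ℝ | q.1 ≤ q.2}.indicator
      (fun q => deriv φ q.2) (z, t) : ℝ) ∂ν = deriv φ t * ν.real (Icc a t) := by
    intro t ht
    have h1 : ∀ z, ({q : ℝ × ℝ | q.1 ≤ q.2}.indicator (fun q => deriv φ q.2) (z, t) : ℝ)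
        = (Iic t).indicator (fun _ => deriv φ t) z := fun z => by
      simp [indicator]
    simp_rw [h1]
    rw [integral_indicator measurableSet_Iic, Measure.restrict_restrict measurableSet_Iic,
      setIntegral_const]
    have h2 : Iic t ∩ Icc a b = Icc a t := by
      ext z; simp only [mem_inter_iff, mem_Iic, mem_Icc]
      constructor
      · rintro ⟨h, h', -⟩; exact ⟨h', h⟩
      · rintro ⟨h, h'⟩; exact ⟨h', h, h'.trans ht.2⟩
    rw [h2, smul_eq_mul, mul_comm]
  rw [setIntegral_congr_fun measurableSet_Icc hL, setIntegral_congr_fun measurableSet_Ioc hR]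
    at hswap
  rw [← hswap, integral_sub (integrable_const _) (hφ.continuous.integrableOn_Icc),
    setIntegral_const]
  simp only [smul_eq_mul]
  ring

/-- The distribution function of `ν` is uniformly `δ`-close to the one of `P`. -/
def CDFClose (P ν : Measure ℝ) (δ : ℝ) : Prop :=
  ∀ y : ℝ, P.real (Iic y) - δ ≤ ν.real (Iio y) ∧ ν.real (Iic y) ≤ P.real (Iic y) + δ

section

variable {P ν : Measure ℝ} [IsFiniteMeasure P] [NullSingletonClass P] [IsFiniteMeasure ν] {δ : ℝ}

/-- `CDFClose` bounds the open half-lines from below, so closed intervals are controlled although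
`ν` may have atoms. With `a = b` the bound says that every atom of `ν` has mass at most `2 * δ`. -/
theorem CDFClose.abs_Icc_sub_le (hc : CDFClose P ν δ) {a b : ℝ} (hab : a ≤ b) :
    |ν.real (Icc a b) - P.real (Icc a b)| ≤ 2 * δ := by
  have h1 : ∀ m : Measure ℝ, IsFiniteMeasure m → m.real (Icc a b) = m.real (Iic b) - m.real (Iio a) := by
    intro m _
    have : Icc a b = Iic b \ Iio a := by ext; simp
    rw [this, measureReal_sdiff (show Iio a ⊆ Iic b from fun z hz => (le_of_lt hz).trans hab)
      measurableSet_Iio]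
  have h2 : P.real (Iio a) = P.real (Iic a) := measureReal_congr Iio_ae_eq_Iic
  rw [h1 ν inferInstance, h1 P inferInstance, h2]
  have ha := hc a
  have hb := hc b
  have h3 : ν.real (Iio a) ≤ ν.real (Iic a) := measureReal_mono Iio_subset_Iic_self
  have h4 : ν.real (Iio b) ≤ ν.real (Iic b) := measureReal_mono Iio_subset_Iic_self
  rw [abs_le]
  constructor <;> linarith [ha.1, ha.2, hb.1, hb.2]

/-- Integration by parts expresses both integrals through masses of intervals `[a, t]`, each of
which changes by at most `2 * δ`. -/
theorem CDFClose.abs_setIntegral_sub_le (hc : CDFClose P ν δ) {φ : ℝ → ℝ} (hφ : ContDiff ℝ 1 φ)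
    {a b B B' : ℝ} (hab : a ≤ b) (hB : |φ b| ≤ B) (hB' : ∀ t ∈ Icc a b, |deriv φ t| ≤ B') :
    |∫ z in Icc a b, φ z ∂ν - ∫ z in Icc a b, φ z ∂P| ≤ (B + B' * (b - a)) * (2 * δ) := by
  have hd : Continuous (deriv φ) := hφ.continuous_deriv le_rfl
  have hδ : 0 ≤ 2 * δ := (abs_nonneg _).trans (hc.abs_Icc_sub_le (le_refl a))
  have hint : ∀ m : Measure ℝ, IsFiniteMeasure m →
      IntegrableOn (fun t => deriv φ t * m.real (Icc a t)) (Ioc a b) volume := by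
    intro m _
    refine Integrable.mul_bdd (c := m.real univ)
      ((hd.integrableOn_Icc).mono_set Ioc_subset_Icc_self) ?_ ?_
    · have : Monotone (fun t => m.real (Icc a t)) := fun s t hst =>
        measureReal_mono (Icc_subset_Icc_right hst)
      exact this.measurable.aestronglyMeasurable
    · exact ae_of_all _ fun t => by
        rw [Real.norm_of_nonneg measureReal_nonneg]; exact measureReal_mono (subset_univ _)
  rw [setIntegral_Icc_eq_sub_integral_measure hφ, setIntegral_Icc_eq_sub_integral_measure hφ]
  have h1 : φ b * ν.real (Icc a b) - (∫ t in Ioc a b, deriv φ t * ν.real (Icc a t)) -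
      (φ b * P.real (Icc a b) - ∫ t in Ioc a b, deriv φ t * P.real (Icc a t)) =
      φ b * (ν.real (Icc a b) - P.real (Icc a b)) -
      ∫ t in Ioc a b, deriv φ t * (ν.real (Icc a t) - P.real (Icc a t)) := by
    simp_rw [mul_sub]
    rw [integral_sub (hint ν inferInstance) (hint P inferInstance)]
    ring
  rw [h1]
  have hB'0 : 0 ≤ B' := (abs_nonneg _).trans (hB' a ⟨le_rfl, hab⟩)
  have h2 : |∫ t in Ioc a b, deriv φ t * (ν.real (Icc a t) - P.real (Icc a t))|
      ≤ (B' * (2 * δ)) * volume.real (Ioc a b) := by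
    rw [← Real.norm_eq_abs]
    refine norm_setIntegral_le_of_norm_le_const measure_Ioc_lt_top (fun t ht => ?_)
    rw [Real.norm_eq_abs, abs_mul]
    exact mul_le_mul (hB' t (Ioc_subset_Icc_self ht)) (hc.abs_Icc_sub_le ht.1.le)
      (abs_nonneg _) hB'0
  have h3 : |φ b * (ν.real (Icc a b) - P.real (Icc a b))| ≤ B * (2 * δ) := by
    rw [abs_mul]
    exact mul_le_mul hB (hc.abs_Icc_sub_le hab) (abs_nonneg _) ((abs_nonneg _).trans hB)
  rw [Real.volume_real_Ioc_of_le hab] at h2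
  calc _ ≤ _ := abs_sub _ _
    _ ≤ B * (2 * δ) + B' * (2 * δ) * (b - a) := add_le_add h3 h2
    _ = _ := by ring

end

/-! ### Symmetrization and unimodal densities -/

/-- Substitution centres the kernel at `y`, and oddness folds the line at `0`. What remains are the
increments of `F` across `y`, weighted by `-k`, which is nonnegative in the applications. -/
theorem integral_odd_kernel_eq {k F : ℝ → ℝ} (hk : Measurable k) (hodd : ∀ v, k (-v) = -k v)
    {C : ℝ} (hC : ∀ v, |k v| ≤ C) (hF : Integrable F) (y : ℝ) :
    ∫ z, k (y - z) * F z = ∫ v in Ioi 0, -k v * (F (y + v) - F (y - v)) := by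
  have h0 : ∫ z, k (y - z) * F z = ∫ v, k v * F (y - v) := by
    rw [← integral_sub_left_eq_self (fun v => k v * F (y - v)) volume y]
    simp
  have hint : Integrable fun v => k v * F (y - v) :=
    (hF.comp_sub_left y).bdd_mul hk.aestronglyMeasurable (ae_of_all _ hC)
  have hint' : Integrable fun v => -(k v * F (y + v)) :=
    ((hF.comp_add_left y).bdd_mul hk.aestronglyMeasurable (ae_of_all _ hC)).neg
  rw [h0, ← intervalIntegral.integral_Iic_add_Ioi (b := 0) hint.integrableOn hint.integrableOn]
  have h1 : ∫ v in Iic 0, k v * F (y - v) = ∫ v in Ioi 0, -(k v * F (y + v)) := by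
    have := integral_comp_neg_Iic (0 : ℝ) (fun v => -(k v * F (y + v)))
    rw [neg_zero] at this
    rw [← this]
    refine setIntegral_congr_fun measurableSet_Iic fun v _ => ?_
    simp [hodd, sub_eq_add_neg]
  rw [h1, ← integral_add hint'.integrableOn hint.integrableOn]
  refine setIntegral_congr_fun measurableSet_Ioi fun v _ => ?_
  ring

/-- Rigidity: a smoothed function which increases in the symmetric sense around `y` has a positive
smoothed derivative, unless it is symmetric around `y` within the range of the kernel. -/
theorem ae_symm_of_integral_odd_kernel_nonpos {k F : ℝ → ℝ} (hk : Measurable k)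
    (hodd : ∀ v, k (-v) = -k v) {C : ℝ} (hC : ∀ v, |k v| ≤ C) {R : ℝ}
    (hneg : ∀ v ∈ Ioo 0 R, k v < 0) (hzero : ∀ v, R ≤ v → k v = 0) (hF : Integrable F) {y : ℝ}
    (hmono : ∀ᵐ v, v ∈ Ioo 0 R → F (y - v) ≤ F (y + v)) (hle : ∫ z, k (y - z) * F z ≤ 0) :
    ∀ᵐ v, v ∈ Ioo 0 R → F (y - v) = F (y + v) := by
  rw [integral_odd_kernel_eq hk hodd hC hF] at hle
  have hint : Integrable fun v => -k v * (F (y + v) - F (y - v)) :=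
    ((hF.comp_add_left y).sub (hF.comp_sub_left y)).bdd_mul hk.neg.aestronglyMeasurable
      (ae_of_all _ fun v => by simpa using hC v)
  have hnn : 0 ≤ᵐ[volume.restrict (Ioi 0)] fun v => -k v * (F (y + v) - F (y - v)) := by
    rw [EventuallyLE, ae_restrict_iff' measurableSet_Ioi]
    filter_upwards [hmono] with v hv hv0
    rcases lt_or_ge v R with h | h
    · exact mul_nonneg (by linarith [hneg v ⟨hv0, h⟩]) (by linarith [hv ⟨hv0, h⟩])
    · simp [hzero v h]
  have heq := (setIntegral_eq_zero_iff_of_nonneg_ae hnn hint.integrableOn).1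
    (le_antisymm hle (integral_nonneg_of_ae hnn))
  rw [EventuallyEq, ae_restrict_iff' measurableSet_Ioi] at heq
  filter_upwards [heq] with v hv hvR
  have h1 := hv hvR.1
  have h2 := hneg v hvR
  simp only [Pi.zero_apply, mul_eq_zero, neg_eq_zero] at h1
  rcases h1 with h1 | h1 <;> linarith

/-- A unimodal density. -/
structure IsUnimodalDensity (g : ℝ) (f : ℝ → ℝ) (I : Set ℝ) : Prop where
  measurable : Measurable f
  nonneg : ∀ y, 0 ≤ f y
  integrable : Integrable f
  ordConnected : I.OrdConnected
  zero_mem : 0 ∈ I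
  eq_zero : ∀ y, y ∉ I → f y = 0
  symm : ∀ y ∈ Icc (-g) g, f (-y) = f y
  strictAntiOn : StrictAntiOn f (Ioi 0 ∩ I)
  strictMonoOn : StrictMonoOn f (Iio 0 ∩ I)

namespace IsUnimodalDensity

variable {g : ℝ} {f : ℝ → ℝ} {I : Set ℝ} (hf : IsUnimodalDensity g f I)
include hf

/-- Lets every statement on one side of the mode be proved for the other side by reflection. -/
theorem reflect : IsUnimodalDensity g (fun y => f (-y)) (-I) where
  measurable := hf.measurable.comp measurable_neg
  nonneg y := hf.nonneg _
  integrable := hf.integrable.comp_neg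
  ordConnected := by
    constructor
    intro a ha b hb c hc
    exact hf.ordConnected.out hb ha ⟨neg_le_neg hc.2, neg_le_neg hc.1⟩
  zero_mem := by simpa using hf.zero_mem
  eq_zero y hy := hf.eq_zero _ hy
  symm y hy := by rw [neg_neg]; exact (hf.symm y hy).symm
  strictAntiOn a ha b hb hab :=
    hf.strictMonoOn ⟨by simpa using hb.1, hb.2⟩ ⟨by simpa using ha.1, ha.2⟩ (neg_lt_neg hab)
  strictMonoOn a ha b hb hab :=
    hf.strictAntiOn ⟨by simpa using hb.1, hb.2⟩ ⟨by simpa using ha.1, ha.2⟩ (neg_lt_neg hab)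

theorem lt_of_mem {u w : ℝ} (huI : u ∈ I) (huw : u < w) (hw : w < 0) : f u < f w :=
  hf.strictMonoOn ⟨huw.trans hw, huI⟩
    ⟨hw, hf.ordConnected.out huI hf.zero_mem ⟨huw.le, hw.le⟩⟩ huw

theorem le_of_lt {u w : ℝ} (huw : u < w) (hw : w < 0) : f u ≤ f w := by
  by_cases huI : u ∈ I
  · exact (hf.lt_of_mem huI huw hw).le
  · rw [hf.eq_zero u huI]; exact hf.nonneg w

/-- Strict monotonicity on `I` leaves equality possible only if `u` lies outside `I`, where the
density vanishes. -/
theorem eq_zero_of_eq {u w : ℝ} (huw : u < w) (hw : w < 0) (h : f u = f w) : f w = 0 := by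
  by_cases huI : u ∈ I
  · exact absurd h (hf.lt_of_mem huI huw hw).ne
  · rw [← h, hf.eq_zero u huI]

/-- If a truncated interval has its centre of mass to the left of the mode in its midpoint, then it
contains the central interval of symmetry. -/
theorem le_neg_of_integral_nonpos (hg : 0 < g) {c r : ℝ} (hc : c < 0)
    (hpos : 0 < ∫ z in Icc (c - r) (c + r), f z)
    (hΦ : ∫ z in Icc (c - r) (c + r), (z - c) * f z ≤ 0) : g ≤ c + r := by
  by_contra! hcg
  have hr : 0 < r := by
    by_contra! hr
    rcases hr.lt_or_eq with hr | hr
    · rw [Icc_eq_empty (by linarith)] at hpos; simp at hpos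
    · simp [hr] at hpos
  -- The first moment about `c` becomes a convolution at `c` with the odd kernel `-v` cut off at
  -- `|v| < r`, to which the rigidity lemma applies.
  let k' : ℝ → ℝ := (Ioo (-r) r).indicator fun v => -v
  have hk' : ∀ v, k' v = if |v| < r then -v else 0 := fun v => by
    simp only [k', indicator, mem_Ioo, abs_lt]
  have hle : ∫ z, k' (c - z) * f z ≤ 0 := by
    refine le_of_eq_of_le ?_ hΦ
    rw [← setIntegral_congr_set Ioo_ae_eq_Icc, ← integral_indicator measurableSet_Ioo]
    congr 1
    ext z
    simp only [hk', indicator, mem_Ioo, abs_lt]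
    have : (-r < c - z ∧ c - z < r) ↔ (c - r < z ∧ z < c + r) := by
      constructor <;> rintro ⟨h1, h2⟩ <;> constructor <;> linarith
    simp only [this]
    split_ifs <;> ring
  have hnull : ∀ᵐ v : ℝ, v ≠ -c := by
    simp [ae_iff]
  have key : ∀ v, v ≠ -c → v ∈ Ioo 0 r →
      f (c - v) ≤ f (c + v) ∧ (f (c - v) = f (c + v) → f (c + v) = 0) := by
    intro v hv hvr
    rcases lt_or_gt_of_ne hv with h | h
    · exact ⟨hf.le_of_lt (by linarith [hvr.1]) (by linarith),
        hf.eq_zero_of_eq (by linarith [hvr.1]) (by linarith)⟩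
    · have h1 : f (c + v) = f (-(c + v)) :=
        (hf.symm _ ⟨by linarith, by linarith [hvr.2]⟩).symm
      rw [h1]
      exact ⟨hf.le_of_lt (by linarith [hvr.1]) (by linarith),
        hf.eq_zero_of_eq (by linarith [hvr.1]) (by linarith)⟩
  have hsymm := ae_symm_of_integral_odd_kernel_nonpos (k := k') (C := r)
    (measurable_neg.indicator measurableSet_Ioo)
    (fun v => by simp only [hk', abs_neg]; split_ifs <;> simp)
    (fun v => by
      rw [hk']; split_ifs with h
      · rw [abs_neg]; exact h.le
      · simpa using hr.le)
    (fun v hv => by rw [hk', if_pos (by rw [abs_of_pos hv.1]; exact hv.2)]; linarith [hv.1])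
    (fun v hv => by rw [hk', if_neg (by rw [abs_of_pos (hr.trans_le hv)]; linarith)])
    hf.integrable (by filter_upwards [hnull] with v hv hvr using (key v hv hvr).1) hle
  have hzero : ∀ᵐ v, v ∈ Ioo 0 r → f (c + v) = 0 ∧ f (c - v) = 0 := by
    filter_upwards [hsymm, hnull] with v h1 h2 h3
    have := (key v h2 h3).2 (h1 h3)
    exact ⟨this, (h1 h3).trans this⟩
  have hA : ∀ᵐ z, z - c ∈ Ioo 0 r → f z = 0 := by
    have := (measurePreserving_sub_right volume c).quasiMeasurePreserving.ae hzero
    filter_upwards [this] with z hz hzr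
    simpa using (hz hzr).1
  have hB : ∀ᵐ z, c - z ∈ Ioo 0 r → f z = 0 := by
    have := (Measure.measurePreserving_sub_left volume c).quasiMeasurePreserving.ae hzero
    filter_upwards [this] with z hz hzr
    simpa using (hz hzr).2
  have hnull' : ∀ᵐ z : ℝ, z ≠ c := by simp [ae_iff]
  -- Equality of the two halves forces the density to vanish almost everywhere on the interval,
  -- contrary to its positive mass.
  have : ∫ z in Icc (c - r) (c + r), f z = 0 := by
    rw [← setIntegral_congr_set Ioo_ae_eq_Icc]
    apply setIntegral_eq_zero_of_ae_eq_zero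
    filter_upwards [hA, hB, hnull'] with z h1 h2 h3 hz
    rcases lt_or_gt_of_ne h3 with h | h
    · exact h2 ⟨by linarith, by linarith [hz.1]⟩
    · exact h1 ⟨by linarith, by linarith [hz.2]⟩
  linarith

/-- The fixed points of the trimmed mean functional are the mode, or they belong to intervals which
contain the central interval of symmetry. -/
theorem eq_zero_or_subset_of_integral_eq_zero (hg : 0 < g) {c r : ℝ}
    (hpos : 0 < ∫ z in Icc (c - r) (c + r), f z)
    (hΦ : ∫ z in Icc (c - r) (c + r), (z - c) * f z = 0) : c = 0 ∨ c - r ≤ -g ∧ g ≤ c + r := by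
  rcases lt_trichotomy c 0 with hc | hc | hc
  · have := hf.le_neg_of_integral_nonpos hg hc hpos hΦ.le
    exact Or.inr ⟨by linarith, this⟩
  · exact Or.inl hc
  · have hrefl : ∀ F : ℝ → ℝ, ∫ z in Icc (-c - r) (-c + r), F (-z) = ∫ z in Icc (c - r) (c + r), F z := by
      intro F
      rw [← integral_indicator measurableSet_Icc, ← integral_indicator measurableSet_Icc,
        ← integral_neg_eq_self]
      congr 1
      ext z
      have : -z ∈ Icc (-c - r) (-c + r) ↔ z ∈ Icc (c - r) (c + r) := by
        constructor <;> rintro ⟨h1, h2⟩ <;> constructor <;> linarith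
      by_cases hz : z ∈ Icc (c - r) (c + r)
      · rw [indicator_of_mem hz, indicator_of_mem (this.2 hz), neg_neg]
      · rw [indicator_of_notMem hz, indicator_of_notMem (fun h => hz (this.1 h))]
    have := hf.reflect.le_neg_of_integral_nonpos hg (c := -c) (r := r) (by linarith)
      (by rw [hrefl f]; exact hpos)
      (by
        have h1 := hrefl fun z => -((z - c) * f z)
        rw [integral_neg (fun z => (z - c) * f z), hΦ, neg_zero] at h1
        rw [← h1]
        apply le_of_eq
        congr 1
        ext z
        ring)
    exact Or.inr ⟨by linarith, by linarith⟩

/-- The derivative of the smoothed truncated density is positive to the left of the mode. -/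
theorem integral_kernel_pos (hg : 0 < g) {k : ℝ → ℝ} (hk : Measurable k)
    (hodd : ∀ v, k (-v) = -k v) {C : ℝ} (hC : ∀ v, |k v| ≤ C)
    (hneg : ∀ v ∈ Ioo 0 g, k v < 0) (hzero : ∀ v, g ≤ v → k v = 0) {a b y : ℝ}
    (hab : a = -b ∨ a ≤ -g ∧ g ≤ b) (hb : 0 ≤ b) (hyI : y ∈ I) (hy : y < 0) (hay : a ≤ y) :
    0 < ∫ z in Icc a b, k (y - z) * f z := by
  by_contra! hle
  set F : ℝ → ℝ := (Icc a b).indicator f with hF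
  have hFint : Integrable F := hf.integrable.indicator measurableSet_Icc
  have hFnn : ∀ z, 0 ≤ F z := fun z => indicator_nonneg (fun z _ => hf.nonneg z) z
  have hFle : ∀ z, F z ≤ f z := fun z => indicator_le_self' (fun z _ => hf.nonneg z) z
  have hle' : ∫ z, k (y - z) * F z ≤ 0 := by
    refine le_of_eq_of_le ?_ hle
    rw [← integral_indicator measurableSet_Icc]
    congr 1
    ext z
    simp only [hF, indicator]
    split_ifs <;> simp
  have hnull : ∀ᵐ v : ℝ, v ≠ -y := by simp [ae_iff]
  have hsymm := ae_symm_of_integral_odd_kernel_nonpos hk hodd hC hneg hzero hFint (y := y) (by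
    filter_upwards [hnull] with v hv hvg
    -- If `y - v` has been cut off, the left value is zero. Otherwise `y + v` has not been cut off
    -- either, since the interval is symmetric or contains `[-g, g]`, and the values of `f` itself
    -- can be compared.
    by_cases ha : a ≤ y - v
    swap
    · have : F (y - v) = 0 := indicator_of_notMem (fun h => ha h.1) _
      rw [this]; exact hFnn _
    have hvb : y + v ≤ b := by
      rcases hab with h | h
      · linarith
      · linarith [hvg.2, h.2]
    have hF1 : F (y + v) = f (y + v) := indicator_of_mem (by constructor <;> linarith [hvg.1]) _
    rw [hF1]
    refine (hFle _).trans ?_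
    rcases lt_or_gt_of_ne hv with h | h
    · exact hf.le_of_lt (by linarith [hvg.1]) (by linarith)
    · rw [← hf.symm (y + v) ⟨by linarith, by linarith [hvg.2]⟩]
      exact hf.le_of_lt (by linarith [hvg.1]) (by linarith)) hle'
  -- For small `v` the point `y + v` is still left of the mode and inside the interval, so `F (y -
  -- v) ≤ f y < f (y + v) = F (y + v)`. The strict inequality uses `y ∈ I`.
  have hfalse : ∀ᵐ v : ℝ, v ∉ Ioo 0 (min (-y) g) := by
    filter_upwards [hsymm] with v hv hvm
    have h1 := hvm.2.trans_le (min_le_left _ _)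
    have h2 := hvm.2.trans_le (min_le_right _ _)
    have h3 := hv ⟨hvm.1, h2⟩
    have hF1 : F (y + v) = f (y + v) := indicator_of_mem (by constructor <;> linarith [hvm.1]) _
    have h4 : f y < f (y + v) := hf.lt_of_mem hyI (by linarith [hvm.1]) (by linarith)
    have h5 : f (y - v) ≤ f y := hf.le_of_lt (by linarith [hvm.1]) hy
    linarith [hFle (y - v)]
  have hvol : volume (Ioo 0 (min (-y) g)) = 0 := by
    rw [ae_iff] at hfalse
    simp only [not_not] at hfalse
    exact hfalse
  rw [Real.volume_Ioo, ENNReal.ofReal_eq_zero] at hvol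
  have : 0 < min (-y) g := lt_min (by linarith) hg
  linarith

end IsUnimodalDensity

/-! ### Compactness: from strict signs to a uniform gap -/

/-- Dominated convergence: the indicators of the moving intervals converge away from the two
limiting endpoints, which are null because `P` has no atoms. -/
theorem continuousAt_setIntegral_Icc {X : Type*} [TopologicalSpace X] [FirstCountableTopology X]
    {P : Measure ℝ} [IsFiniteMeasure P] [NullSingletonClass P] {u v : X → ℝ} (hu : Continuous u)
    (hv : Continuous v) {φ : X → ℝ → ℝ} (hφ : Continuous (Function.uncurry φ)) {C : ℝ} {x₀ : X}
    (hb : ∀ᶠ x in 𝓝 x₀, ∀ z ∈ Icc (u x) (v x), |φ x z| ≤ C) (hC : 0 ≤ C) :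
    ContinuousAt (fun x => ∫ z in Icc (u x) (v x), φ x z ∂P) x₀ := by
  simp_rw [← integral_indicator measurableSet_Icc]
  have hφx : ∀ x, Continuous (φ x) := fun x => hφ.comp (Continuous.prodMk_right x)
  have hφz : ∀ z, Continuous fun x => φ x z := fun z => hφ.comp (Continuous.prodMk_left z)
  refine continuousAt_of_dominated (bound := fun _ => C) ?_ ?_ (integrable_const C) ?_
  · exact Eventually.of_forall fun x =>
      ((hφx x).measurable.indicator measurableSet_Icc).aestronglyMeasurable
  · filter_upwards [hb] with x hx
    refine ae_of_all _ fun z => ?_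
    by_cases hz : z ∈ Icc (u x) (v x)
    · rw [indicator_of_mem hz]; exact hx z hz
    · rw [indicator_of_notMem hz]; simpa using hC
  · have h1 : ∀ᵐ z ∂P, z ≠ u x₀ := by simp [ae_iff]
    have h2 : ∀ᵐ z ∂P, z ≠ v x₀ := by simp [ae_iff]
    filter_upwards [h1, h2] with z hz1 hz2
    rcases lt_or_gt_of_ne hz1 with h | h
    · refine (continuousAt_const (y := (0 : ℝ))).congr ?_
      filter_upwards [hu.continuousAt.eventually_const_lt h] with x hx
      exact (indicator_of_notMem (fun hz => absurd hz.1 (not_le.2 hx)) _).symm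
    rcases lt_or_gt_of_ne hz2 with h' | h'
    · refine ((hφz z).continuousAt).congr ?_
      filter_upwards [hu.continuousAt.eventually_lt_const h, hv.continuousAt.eventually_const_lt h']
        with x hx hx'
      exact (indicator_of_mem (show z ∈ Icc (u x) (v x) from ⟨hx.le, hx'.le⟩) _).symm
    · refine (continuousAt_const (y := (0 : ℝ))).congr ?_
      filter_upwards [hv.continuousAt.eventually_lt_const h'] with x hx
      exact (indicator_of_notMem (fun hz => absurd hz.2 (not_le.2 hx)) _).symm

/-- The derivative of a score kernel. -/
structure IsOddKernel (g : ℝ) (k : ℝ → ℝ) : Prop where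
  contDiff : ContDiff ℝ 1 k
  odd : ∀ v, k (-v) = -k v
  neg : ∀ v ∈ Ioo 0 g, k v < 0
  eq_zero : ∀ v, g ≤ v → k v = 0

namespace IsOddKernel

variable {g : ℝ} {k : ℝ → ℝ} (hk : IsOddKernel g k)
include hk

theorem eq_zero_of_le_neg {v : ℝ} (hv : v ≤ -g) : k v = 0 := by
  have := hk.odd (-v)
  rw [neg_neg, hk.eq_zero (-v) (by linarith)] at this
  simpa using this

theorem hasCompactSupport : HasCompactSupport k :=
  HasCompactSupport.intro (isCompact_Icc (a := -g) (b := g)) fun v hv => by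
    rw [mem_Icc, not_and_or, not_le, not_le] at hv
    rcases hv with h | h
    · exact hk.eq_zero_of_le_neg h.le
    · exact hk.eq_zero v h.le

theorem exists_bound : ∃ C, 0 ≤ C ∧ (∀ v, |k v| ≤ C) ∧ ∀ v, |deriv k v| ≤ C := by
  obtain ⟨C₁, h₁⟩ := hk.hasCompactSupport.exists_bound_of_continuous hk.contDiff.continuous
  obtain ⟨C₂, h₂⟩ := hk.hasCompactSupport.deriv.exists_bound_of_continuous
    (hk.contDiff.continuous_deriv le_rfl)
  exact ⟨max C₁ C₂, (norm_nonneg _).trans ((h₁ 0).trans (le_max_left _ _)),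
    fun v => (h₁ v).trans (le_max_left _ _), fun v => (h₂ v).trans (le_max_right _ _)⟩

end IsOddKernel

section Population

variable {g : ℝ} {f : ℝ → ℝ} {I : Set ℝ} (hf : IsUnimodalDensity g f I) {P : Measure ℝ}
  (hP : P = volume.withDensity fun y => ENNReal.ofReal (f y))
include hf hP

theorem IsUnimodalDensity.setIntegral_eq (φ : ℝ → ℝ) (a b : ℝ) :
    ∫ z in Icc a b, φ z ∂P = ∫ z in Icc a b, φ z * f z := by
  rw [hP, setIntegral_withDensity_eq_setIntegral_toReal_smul₀
    hf.measurable.ennreal_ofReal.aemeasurable (ae_of_all _ fun _ => ENNReal.ofReal_lt_top) _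
    measurableSet_Icc]
  refine setIntegral_congr_fun measurableSet_Icc fun z _ => ?_
  simp only [ENNReal.toReal_ofReal (hf.nonneg z), smul_eq_mul, mul_comm]

variable (hg : 0 < g) {k : ℝ → ℝ} (hk : IsOddKernel g k)
include hg hk

theorem IsUnimodalDensity.setIntegral_kernel_pos {a b y : ℝ}
    (hab : a = -b ∨ a ≤ -g ∧ g ≤ b) (hb : 0 ≤ b) (hyI : y ∈ I) (hy : y < 0) (hay : a ≤ y) :
    0 < ∫ z in Icc a b, k (y - z) ∂P := by
  obtain ⟨C, -, hC, -⟩ := hk.exists_bound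
  rw [hf.setIntegral_eq hP]
  exact hf.integral_kernel_pos hg hk.contDiff.continuous.measurable hk.odd hC hk.neg hk.eq_zero
    hab hb hyI hy hay

theorem IsUnimodalDensity.setIntegral_kernel_neg {a b y : ℝ}
    (hab : a = -b ∨ a ≤ -g ∧ g ≤ b) (hyI : y ∈ I) (hy : 0 < y) (hay : y ≤ b) :
    ∫ z in Icc a b, k (y - z) ∂P < 0 := by
  obtain ⟨C, -, hC, -⟩ := hk.exists_bound
  rw [hf.setIntegral_eq hP]
  have h := hf.reflect.integral_kernel_pos hg hk.contDiff.continuous.measurable hk.odd hC hk.neg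
    hk.eq_zero (a := -b) (b := -a) (y := -y)
    (by rcases hab with h | h
        · left; linarith
        · right; constructor <;> linarith)
    (by rcases hab with h | h <;> linarith) (by simpa using hyI) (by linarith) (by linarith)
  have h2 : ∫ z in Icc (-b) (-a), k (-y - z) * f (-z) = -∫ z in Icc a b, k (y - z) * f z := by
    rw [← integral_neg, ← integral_indicator measurableSet_Icc,
      ← integral_indicator measurableSet_Icc, ← integral_neg_eq_self]
    congr 1
    ext z
    have : -z ∈ Icc (-b) (-a) ↔ z ∈ Icc a b := by
      constructor <;> rintro ⟨h1, h2⟩ <;> constructor <;> linarith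
    by_cases hz : z ∈ Icc a b
    · rw [indicator_of_mem hz, indicator_of_mem (this.2 hz), neg_neg,
        show -y - -z = -(y - z) by ring, hk.odd, neg_mul]
    · rw [indicator_of_notMem hz, indicator_of_notMem (fun h => hz (this.1 h))]
  rw [h2] at h
  linarith

/-- Approximate fixed points of the trimmed mean functional belong to intervals around the mode on
which the smoothed truncated density is uniformly strictly monotone on both sides of the mode. -/
theorem IsUnimodalDensity.exists_gap [IsProbabilityMeasure P] {l : ℝ} (hl : l < 1) {s t η : ℝ} (hs : s ∈ I) (ht : t ∈ I)
    (hη : 0 < η) (hηg : η < g) (hηP : P.real (Icc (-η) η) < 1 - l) (B : ℝ) :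
    ∃ κ > 0, ∀ c ∈ Icc (-B) B, ∀ r ∈ Icc 0 B, |∫ z in Icc (c - r) (c + r), (z - c) ∂P| < κ →
      |P.real (Icc (c - r) (c + r)) - (1 - l)| < κ → (c - r < -η ∧ η < c + r) ∧
      (∀ y ∈ Icc s (-η), c - r ≤ y → κ ≤ ∫ z in Icc (c - r) (c + r), k (y - z) ∂P) ∧
      (∀ y ∈ Icc η t, y ≤ c + r → ∫ z in Icc (c - r) (c + r), k (y - z) ∂P ≤ -κ) := by
  have hnull : NullSingletonClass P := by rw [hP]; infer_instance
  obtain ⟨C, hC0, hC, -⟩ := hk.exists_bound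
  let Φ : ℝ × ℝ × ℝ → ℝ := fun x => ∫ z in Icc (x.1 - x.2.1) (x.1 + x.2.1), (z - x.1) ∂P
  let G : ℝ × ℝ × ℝ → ℝ := fun x => P.real (Icc (x.1 - x.2.1) (x.1 + x.2.1)) - (1 - l)
  let Ψ : ℝ × ℝ × ℝ → ℝ := fun x => ∫ z in Icc (x.1 - x.2.1) (x.1 + x.2.1), k (x.2.2 - z) ∂P
  have hu : Continuous fun x : ℝ × ℝ × ℝ => x.1 - x.2.1 := by fun_prop
  have hv : Continuous fun x : ℝ × ℝ × ℝ => x.1 + x.2.1 := by fun_prop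
  have hΦ : Continuous Φ := by
    rw [continuous_iff_continuousAt]
    intro x₀
    refine continuousAt_setIntegral_Icc hu hv (φ := fun x z => z - x.1) (by fun_prop)
      (C := |x₀.2.1| + 1) ?_ (by positivity)
    have h1 : ContinuousAt (fun x : ℝ × ℝ × ℝ => |x.2.1|) x₀ := by fun_prop
    filter_upwards [h1.eventually_lt_const (lt_add_one _)] with x hx z hz
    refine le_trans ?_ hx.le
    rw [abs_le]
    constructor <;> linarith [hz.1, hz.2, le_abs_self x.2.1]
  have hG : Continuous G := by
    have : Continuous fun x : ℝ × ℝ × ℝ => ∫ _ in Icc (x.1 - x.2.1) (x.1 + x.2.1), (1 : ℝ) ∂P := by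
      rw [continuous_iff_continuousAt]
      intro x₀
      exact continuousAt_setIntegral_Icc hu hv (φ := fun _ _ => (1 : ℝ)) (by fun_prop)
        (C := 1) (by simp) zero_le_one
    simp only [setIntegral_const, smul_eq_mul, mul_one] at this
    exact this.sub continuous_const
  have hΨ : Continuous Ψ := by
    rw [continuous_iff_continuousAt]
    intro x₀
    have := hk.contDiff.continuous
    exact continuousAt_setIntegral_Icc hu hv (φ := fun x z => k (x.2.2 - z)) (by fun_prop)
      (C := C) (Eventually.of_forall fun x z _ => hC _) hC0
  -- Exact fixed points. If `c = 0` the interval is symmetric, and its mass `1 - l > P [-η, η]`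
  -- makes its radius exceed `η`; otherwise it contains `[-g, g]`, and `η < g`.
  have hfix : ∀ x : ℝ × ℝ × ℝ, Φ x = 0 → G x = 0 → (x.1 - x.2.1 < -η ∧ η < x.1 + x.2.1) ∧
      (x.1 - x.2.1 = -(x.1 + x.2.1) ∨ x.1 - x.2.1 ≤ -g ∧ g ≤ x.1 + x.2.1) := by
    intro x h1 h2
    have h3 : P.real (Icc (x.1 - x.2.1) (x.1 + x.2.1)) = 1 - l := sub_eq_zero.1 h2
    have h4 : P.real (Icc (x.1 - x.2.1) (x.1 + x.2.1))
        = ∫ z in Icc (x.1 - x.2.1) (x.1 + x.2.1), f z := by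
      have := hf.setIntegral_eq hP (fun _ => 1) (x.1 - x.2.1) (x.1 + x.2.1)
      simpa [setIntegral_const] using this
    have h5 := h1
    simp only [Φ] at h5
    rw [hf.setIntegral_eq hP] at h5
    rcases hf.eq_zero_or_subset_of_integral_eq_zero hg (by rw [← h4, h3]; linarith) h5 with h | h
    · rw [h] at h3 ⊢
      have : η < x.2.1 := by
        by_contra! hle
        have := measureReal_mono (μ := P)
          (Icc_subset_Icc (show -η ≤ 0 - x.2.1 by linarith) (show 0 + x.2.1 ≤ η by linarith))
        linarith
      exact ⟨⟨by linarith, by linarith⟩, Or.inl (by ring)⟩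
    · exact ⟨⟨by linarith, by linarith⟩, Or.inr h⟩
  have hpos : ∀ x : ℝ × ℝ × ℝ, 0 ≤ max |Φ x| |G x| ∧ (max |Φ x| |G x| ≤ 0 → Φ x = 0 ∧ G x = 0) := by
    intro x
    refine ⟨(abs_nonneg _).trans (le_max_left _ _), fun h => ?_⟩
    rw [max_le_iff, abs_nonpos_iff, abs_nonpos_iff] at h
    exact h
  let Box : Set (ℝ × ℝ × ℝ) := Icc (-B) B ×ˢ Icc 0 B ×ˢ Icc s (-η)
  let Box' : Set (ℝ × ℝ × ℝ) := Icc (-B) B ×ˢ Icc 0 B ×ˢ Icc η t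
  let Box₀ : Set (ℝ × ℝ × ℝ) := Icc (-B) B ×ˢ Icc 0 B ×ˢ {0}
  have hBox : IsCompact Box := isCompact_Icc.prod (isCompact_Icc.prod isCompact_Icc)
  have hBox' : IsCompact Box' := isCompact_Icc.prod (isCompact_Icc.prod isCompact_Icc)
  have hBox₀ : IsCompact Box₀ := isCompact_Icc.prod (isCompact_Icc.prod isCompact_singleton)
  -- A maximum of the fixed-point defect and the desired quantity is positive on a compact set,
  -- hence bounded below by a positive constant. Where the defect is below this constant, the
  -- desired quantity must exceed it. The next two bounds use the same device.
  obtain ⟨κ₀, hκ₀, h₀⟩ := hBox₀.exists_forall_le'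
    (f := fun x => max (max |Φ x| |G x|) (min (-η - (x.1 - x.2.1)) (x.1 + x.2.1 - η)))
    (by fun_prop) (a := 0) (by
      intro x _
      by_contra! h
      rw [max_le_iff] at h
      obtain ⟨h1, h2⟩ := (hpos x).2 h.1
      obtain ⟨⟨h3, h4⟩, -⟩ := hfix x h1 h2
      have := lt_min (a := (0 : ℝ)) (show 0 < -η - (x.1 - x.2.1) by linarith)
        (show 0 < x.1 + x.2.1 - η by linarith)
      linarith [h.2])
  obtain ⟨κ₁, hκ₁, h₁⟩ := (hBox.inter_right (isClosed_le hu
      (show Continuous fun x : ℝ × ℝ × ℝ => x.2.2 by fun_prop))).exists_forall_le'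
    (f := fun x => max (max |Φ x| |G x|) (Ψ x))
    (by fun_prop) (a := 0) (by
      rintro x ⟨⟨-, -, hx1, hx2⟩, hx3⟩
      by_contra! h
      rw [max_le_iff] at h
      obtain ⟨h1, h2⟩ := (hpos x).2 h.1
      obtain ⟨⟨h3, h4⟩, h5⟩ := hfix x h1 h2
      have := hf.setIntegral_kernel_pos hP hg hk h5 (by linarith)
        (hf.ordConnected.out hs hf.zero_mem ⟨hx1, by linarith⟩) (y := x.2.2) (by linarith) hx3
      exact absurd h.2 (not_le.2 this))
  obtain ⟨κ₂, hκ₂, h₂⟩ := (hBox'.inter_right (isClosed_le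
      (show Continuous fun x : ℝ × ℝ × ℝ => x.2.2 by fun_prop) hv)).exists_forall_le'
    (f := fun x => max (max |Φ x| |G x|) (-Ψ x))
    (by fun_prop) (a := 0) (by
      rintro x ⟨⟨-, -, hx1, hx2⟩, hx3⟩
      by_contra! h
      rw [max_le_iff] at h
      obtain ⟨h1, h2⟩ := (hpos x).2 h.1
      obtain ⟨⟨h3, h4⟩, h5⟩ := hfix x h1 h2
      have : Ψ x < 0 := hf.setIntegral_kernel_neg hP hg hk h5
        (hf.ordConnected.out hf.zero_mem ht ⟨by linarith, hx2⟩) (y := x.2.2) (by linarith) hx3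
      linarith [h.2])
  refine ⟨min κ₀ (min κ₁ κ₂), lt_min hκ₀ (lt_min hκ₁ hκ₂), fun c hc r hr hcΦ hcG => ?_⟩
  have hκa := min_le_left κ₀ (min κ₁ κ₂)
  have hκb := (min_le_right κ₀ (min κ₁ κ₂)).trans (min_le_left _ _)
  have hκc := (min_le_right κ₀ (min κ₁ κ₂)).trans (min_le_right _ _)
  have hmax : max |∫ z in Icc (c - r) (c + r), (z - c) ∂P|
    |P.real (Icc (c - r) (c + r)) - (1 - l)| < min κ₀ (min κ₁ κ₂) := max_lt hcΦ hcG
  refine ⟨?_, fun y hy hcy => ?_, fun y hy hcy => ?_⟩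
  · have h3 := h₀ (c, r, 0) ⟨hc, hr, rfl⟩
    rcases le_max_iff.1 h3 with h4 | h4
    · exact absurd (hmax.trans_le hκa) (not_lt.2 h4)
    · rw [le_min_iff] at h4
      simp only at h4
      constructor <;> linarith [h4.1, h4.2]
  · rcases le_max_iff.1 (h₁ (c, r, y) ⟨⟨hc, hr, hy⟩, hcy⟩) with h4 | h4
    · exact absurd (hmax.trans_le hκb) (not_lt.2 h4)
    · exact hκb.trans h4
  · rcases le_max_iff.1 (h₂ (c, r, y) ⟨⟨hc, hr, hy⟩, hcy⟩) with h4 | h4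
    · exact absurd (hmax.trans_le hκc) (not_lt.2 h4)
    · have : κ₂ ≤ -∫ z in Icc (c - r) (c + r), k (y - z) ∂P := h4
      linarith

end Population

/-! ### Weighted empirical measures -/

/-- The measure with mass `w p` at the observation `Z p`, `p ∈ J`. -/
noncomputable def weightedEmpirical {ι : Type} (J : Finset ι) (w Z : ι → ℝ) : Measure ℝ :=
  ∑ p ∈ J, ENNReal.ofReal (w p) • Measure.dirac (Z p)

section

variable {ι : Type} {J : Finset ι} {w Z : ι → ℝ}

instance : IsFiniteMeasure (weightedEmpirical J w Z) := by
  refine ⟨?_⟩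
  simp only [weightedEmpirical, Measure.coe_finsetSum, Finset.sum_apply, Measure.smul_apply,
    measure_univ, smul_eq_mul, mul_one]
  exact ENNReal.sum_lt_top.2 fun _ _ => ENNReal.ofReal_lt_top

theorem setIntegral_weightedEmpirical (hw : ∀ p ∈ J, 0 ≤ w p) {A : Set ℝ} [DecidablePred (· ∈ A)]
    (hA : MeasurableSet A) (φ : ℝ → ℝ) :
    ∫ z in A, φ z ∂(weightedEmpirical J w Z) = ∑ p ∈ J with Z p ∈ A, w p * φ (Z p) := by
  rw [← integral_indicator hA, weightedEmpirical, integral_finsetSum_measure, Finset.sum_filter]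
  · refine Finset.sum_congr rfl fun p hp => ?_
    rw [integral_smul_measure, integral_dirac, ENNReal.toReal_ofReal (hw p hp), smul_eq_mul]
    split_ifs with h
    · rw [indicator_of_mem h]
    · rw [indicator_of_notMem h, mul_zero]
  · intro p _
    exact (integrable_dirac (by simp)).smul_measure ENNReal.ofReal_ne_top

theorem weightedEmpirical_real (hw : ∀ p ∈ J, 0 ≤ w p) {A : Set ℝ} [DecidablePred (· ∈ A)]
    (hA : MeasurableSet A) :
    (weightedEmpirical J w Z).real A = ∑ p ∈ J with Z p ∈ A, w p := by
  have := setIntegral_weightedEmpirical (Z := Z) hw hA (fun _ => 1)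
  simpa using this

end

/-! ### Trimmed means of samples close to the error law -/

/-- An upper bound for a mean of observations most of which belong to `[-M, M]`. -/
theorem mean_le_of_card_le {ι : Type} {S : Finset ι} {Z : ι → ℝ} {c ρ M N l : ℝ}
    (hM : 0 ≤ M) (hN : 0 < N) (hl : l ∈ Ioo (0 : ℝ) (1 / 2)) (hS : ∀ p ∈ S, |Z p - c| ≤ ρ)
    (hρ : ρ ≤ M + |c|) (hsum : ∑ p ∈ S, (Z p - c) = 0)
    (hin : (1 - 3 * l / 2) * N ≤ ((S.filter fun p => |Z p| ≤ M).card : ℝ))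
    (hout : ((S.filter fun p => ¬ |Z p| ≤ M).card : ℝ) ≤ l / 2 * N) :
    c ≤ M / (1 - 2 * l) := by
  have hl' : 0 < 1 - 2 * l := by linarith [hl.2]
  rw [le_div_iff₀ hl']
  rcases le_or_gt c M with hcM | hcM
  · rcases le_or_gt c 0 with h0 | h0
    · nlinarith
    · nlinarith [hl.1]
  rw [abs_of_pos (by linarith)] at hρ
  rw [← Finset.sum_filter_add_sum_filter_not S (fun p => |Z p| ≤ M)] at hsum
  have h1 : ∑ p ∈ S with |Z p| ≤ M, (Z p - c) ≤ (S.filter fun p => |Z p| ≤ M).card • (M - c) :=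
    Finset.sum_le_card_nsmul _ _ _ fun p hp => by
      have := (abs_le.1 (Finset.mem_filter.1 hp).2).2
      linarith
  have h2 : ∑ p ∈ S with ¬ |Z p| ≤ M, (Z p - c) ≤
      (S.filter fun p => ¬ |Z p| ≤ M).card • (M + c) :=
    Finset.sum_le_card_nsmul _ _ _ fun p hp => by
      have := (abs_le.1 (hS p (Finset.mem_filter.1 hp).1)).2
      linarith
  rw [nsmul_eq_mul] at h1 h2
  -- If `c > M`, at least `(1 - 3 * l / 2) * N` points pull the mean down by `c - M`, and at most `l
  -- / 2 * N` points pull it up by at most `M + c`. The balance is `(1 - 2 * l) * c ≤ (1 - l) * M`.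
  have h3 : 0 ≤ N * ((1 - 3 * l / 2) * (M - c) + l / 2 * (M + c)) := by nlinarith
  have h4 := nonneg_of_mul_nonneg_right h3 hN
  nlinarith [hl.1]

theorem abs_le_of_card_le {ι : Type} {S : Finset ι} {Z : ι → ℝ} {c ρ M N l : ℝ}
    (hM : 0 ≤ M) (hN : 0 < N) (hl : l ∈ Ioo (0 : ℝ) (1 / 2)) (hS : ∀ p ∈ S, |Z p - c| ≤ ρ)
    (hρ : ρ ≤ M + |c|) (hsum : ∑ p ∈ S, (Z p - c) = 0)
    (hin : (1 - 3 * l / 2) * N ≤ ((S.filter fun p => |Z p| ≤ M).card : ℝ))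
    (hout : ((S.filter fun p => ¬ |Z p| ≤ M).card : ℝ) ≤ l / 2 * N) :
    |c| ≤ M / (1 - 2 * l) := by
  rw [abs_le']
  refine ⟨mean_le_of_card_le hM hN hl hS hρ hsum hin hout, ?_⟩
  have h : ∀ p, -Z p - -c = -(Z p - c) := fun p => by ring
  refine mean_le_of_card_le (Z := fun p => -Z p) (ρ := ρ) hM hN hl (fun p hp => ?_)
    (by rwa [abs_neg]) ?_
    (by simpa using hin) (by simpa using hout)
  · rw [h, abs_neg]; exact hS p hp
  · simp only [h, Finset.sum_neg_distrib, hsum, neg_zero]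

/-- The trimmed sample: its centre `c` is the mean of a set `S` consisting of the `⌈(1 - l) #J⌉`
observations which are closest to `c`. -/
structure IsTrimmedMean {ι : Type} (J : Finset ι) (Z : ι → ℝ) (l c ρ : ℝ) (S : Finset ι) :
    Prop where
  nonneg : 0 ≤ ρ
  subset : S ⊆ J
  card : S.card = J.card - ⌊(J.card : ℝ) * l⌋₊
  le : ∀ p ∈ S, |Z p - c| ≤ ρ
  ge : ∀ p ∈ J, p ∉ S → ρ ≤ |Z p - c|
  sum_eq_zero : ∑ p ∈ S, (Z p - c) = 0

section TrimmedMean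

variable {ι : Type} {J S : Finset ι} {Z : ι → ℝ} {l c ρ δ : ℝ} {P : Measure ℝ}
  [IsProbabilityMeasure P] [NullSingletonClass P]

theorem IsTrimmedMean.card_bounds (h : IsTrimmedMean J Z l c ρ S) (hl : l ∈ Ioo (0 : ℝ) (1 / 2)) :
    (1 - l) * J.card ≤ S.card ∧ (S.card : ℝ) ≤ (1 - l) * J.card + 1 := by
  have h1 : ⌊(J.card : ℝ) * l⌋₊ ≤ J.card := by
    apply Nat.floor_le_of_le
    nlinarith [J.card.cast_nonneg (α := ℝ), hl.2]
  rw [h.card, Nat.cast_sub h1]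
  have h0 : 0 ≤ (J.card : ℝ) * l := mul_nonneg (Nat.cast_nonneg _) hl.1.le
  have h2 := Nat.floor_le h0
  have h3 := Nat.lt_floor_add_one ((J.card : ℝ) * l)
  constructor <;> linarith

/-- Population versions of the defining equations of a trimmed mean. -/
theorem IsTrimmedMean.population (h : IsTrimmedMean J Z l c ρ S) (hl : l ∈ Ioo (0 : ℝ) (1 / 2))
    (hJ : J.Nonempty) (hδ : 1 / (J.card : ℝ) ≤ δ)
    (hc : CDFClose P (weightedEmpirical J (fun _ => 1 / (J.card : ℝ)) Z) δ) :
    |P.real (Icc (c - ρ) (c + ρ)) - (1 - l)| ≤ 7 * δ ∧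
      |∫ z in Icc (c - ρ) (c + ρ), (z - c) ∂P| ≤ 10 * ρ * δ := by
  classical
  have hN : (0 : ℝ) < J.card := by exact_mod_cast hJ.card_pos
  set ν := weightedEmpirical J (fun _ => 1 / (J.card : ℝ)) Z with hν
  have hw : ∀ p ∈ J, (0 : ℝ) ≤ (fun _ => 1 / (J.card : ℝ)) p := fun _ _ => by positivity
  set R := J.filter fun p => Z p ∈ Icc (c - ρ) (c + ρ) with hR
  have hmem : ∀ p, Z p ∈ Icc (c - ρ) (c + ρ) ↔ |Z p - c| ≤ ρ := fun p => by
    rw [abs_le, mem_Icc]; constructor <;> rintro ⟨h1, h2⟩ <;> constructor <;> linarith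
  have hSR : S ⊆ R := fun p hp => Finset.mem_filter.2 ⟨h.subset hp, (hmem p).2 (h.le p hp)⟩
  have hνI : ν.real (Icc (c - ρ) (c + ρ)) = R.card / J.card := by
    rw [hν, weightedEmpirical_real hw measurableSet_Icc, ← hR]
    simp [div_eq_mul_inv]
  have hρ := h.nonneg
  have hatom : ∀ a, ν.real {a} ≤ 2 * δ := fun a => by
    have := hc.abs_Icc_sub_le (le_refl a)
    simp only [Icc_self, measureReal_def P, measure_singleton, ENNReal.toReal_zero, sub_zero] at this
    exact (le_abs_self _).trans this
  -- Retained indices outside `S` are ties at distance exactly `ρ`, so they sit in the two atoms at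
  -- `c - ρ` and `c + ρ`, each of mass at most `2 * δ`.
  have hdiff : ((R \ S).card : ℝ) / J.card ≤ 4 * δ := by
    have hsub : R \ S ⊆ (J.filter fun p => Z p ∈ ({c - ρ} : Set ℝ)) ∪
        J.filter fun p => Z p ∈ ({c + ρ} : Set ℝ) := by
      intro p hp
      rw [Finset.mem_sdiff, hR, Finset.mem_filter, hmem] at hp
      have heq : |Z p - c| = ρ := le_antisymm hp.1.2 (h.ge p hp.1.1 hp.2)
      simp only [Finset.mem_union, Finset.mem_filter, mem_singleton_iff, hp.1.1, true_and]
      rcases (abs_eq hρ).1 heq with h1 | h1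
      · right; linarith
      · left; linarith
    have h1 := Finset.card_le_card hsub
    have h2 := Finset.card_union_le (J.filter fun p => Z p ∈ ({c - ρ} : Set ℝ))
      (J.filter fun p => Z p ∈ ({c + ρ} : Set ℝ))
    have h3 : ∀ a, ν.real {a} = ((J.filter fun p => Z p ∈ ({a} : Set ℝ)).card : ℝ) / J.card := by
      intro a
      rw [hν, weightedEmpirical_real hw (measurableSet_singleton a)]
      simp [div_eq_mul_inv]
    have h4 := hatom (c - ρ)
    have h5 := hatom (c + ρ)
    rw [h3] at h4 h5
    calc ((R \ S).card : ℝ) / J.card ≤ (((J.filter fun p => Z p ∈ ({c - ρ} : Set ℝ)).card : ℝ) +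
          (J.filter fun p => Z p ∈ ({c + ρ} : Set ℝ)).card) / J.card := by
          gcongr
          exact_mod_cast h1.trans h2
      _ ≤ 4 * δ := by rw [add_div]; linarith
  obtain ⟨hc1, hc2⟩ := h.card_bounds hl
  have hcard : (R.card : ℝ) = S.card + (R \ S).card := by
    rw [← Finset.card_sdiff_add_card_eq_card hSR]; push_cast; ring
  have hS1 : 1 - l ≤ (S.card : ℝ) / J.card := by rwa [le_div_iff₀ hN]
  have hS2 : (S.card : ℝ) / J.card ≤ 1 - l + δ := by
    refine le_trans ?_ (add_le_add_right hδ _)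
    rw [div_le_iff₀ hN, add_mul, one_div, inv_mul_cancel₀ hN.ne']
    exact hc2
  have hpos : (0 : ℝ) ≤ ((R \ S).card : ℝ) / J.card := by positivity
  have hI := hc.abs_Icc_sub_le (show c - ρ ≤ c + ρ by linarith)
  constructor
  · rw [hνI, hcard, add_div] at hI
    rw [abs_le] at hI ⊢
    constructor <;> linarith [hI.1, hI.2]
  · have hφ := hc.abs_setIntegral_sub_le (φ := fun z => z - c) (by fun_prop)
      (show c - ρ ≤ c + ρ by linarith) (B := ρ) (B' := 1)
      (by simp [abs_of_nonneg hρ]) (fun t _ => by simp)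
    have hsum : ∫ z in Icc (c - ρ) (c + ρ), (z - c) ∂ν = (∑ p ∈ R \ S, (Z p - c)) / J.card := by
      rw [hν, setIntegral_weightedEmpirical hw measurableSet_Icc, ← hR, ← Finset.mul_sum,
        ← Finset.sum_sdiff hSR, h.sum_eq_zero, add_zero]
      ring
    have hsmall : |∫ z in Icc (c - ρ) (c + ρ), (z - c) ∂ν| ≤ 4 * δ * ρ := by
      rw [hsum, abs_div, abs_of_pos hN]
      have h1 : |∑ p ∈ R \ S, (Z p - c)| ≤ (R \ S).card • ρ :=
        (Finset.abs_sum_le_sum_abs _ _).trans (Finset.sum_le_card_nsmul _ _ _ fun p hp =>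
          (hmem p).1 (Finset.mem_filter.1 (Finset.mem_sdiff.1 hp).1).2)
      rw [nsmul_eq_mul] at h1
      calc _ ≤ ((R \ S).card : ℝ) * ρ / J.card := by gcongr
        _ = ((R \ S).card : ℝ) / J.card * ρ := by ring
        _ ≤ 4 * δ * ρ := by gcongr
    rw [abs_le] at hφ hsmall ⊢
    constructor <;> linarith [hφ.1, hφ.2, hsmall.1, hsmall.2]

/-- The breakdown property of LTS: with `l < 1/2`, the few observations outside `[-M, M]` can
neither carry the centre away nor inflate the radius. This supplies the compact box for the gap
argument. -/
theorem IsTrimmedMean.bounds (h : IsTrimmedMean J Z l c ρ S) (hl : l ∈ Ioo (0 : ℝ) (1 / 2))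
    (hJ : J.Nonempty) (hδ : 1 / (J.card : ℝ) ≤ δ) (hδl : δ ≤ l / 8) {M : ℝ} (hM : 0 ≤ M)
    (hPM : 1 - l / 8 ≤ P.real (Icc (-M) M))
    (hc : CDFClose P (weightedEmpirical J (fun _ => 1 / (J.card : ℝ)) Z) δ) :
    |c| ≤ M / (1 - 2 * l) ∧ ρ ≤ M + M / (1 - 2 * l) := by
  classical
  have hN : (0 : ℝ) < J.card := by exact_mod_cast hJ.card_pos
  have hw : ∀ p ∈ J, (0 : ℝ) ≤ (fun _ => 1 / (J.card : ℝ)) p := fun _ _ => by positivity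
  have hI := hc.abs_Icc_sub_le (show -M ≤ M by linarith)
  rw [weightedEmpirical_real hw measurableSet_Icc] at hI
  simp only [← abs_le, mem_Icc, Finset.sum_const, nsmul_eq_mul, mul_one_div] at hI
  have hA : 1 - 3 * l / 8 ≤ ((J.filter fun p => |Z p| ≤ M).card : ℝ) / J.card := by
    linarith [(abs_le.1 hI).1]
  rw [le_div_iff₀ hN] at hA
  have hδN : 1 ≤ δ * J.card := by rwa [div_le_iff₀ hN] at hδ
  have hl8 : δ * J.card ≤ l / 8 * J.card := by gcongr
  obtain ⟨hc1, hc2⟩ := h.card_bounds hl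
  have hlN : 0 < l * J.card := mul_pos hl.1 hN
  have hρ : ρ ≤ M + |c| := by
    by_contra! hlt
    -- With a larger radius, every observation in `[-M, M]` would belong to `S`, but these are at
    -- least `(1 - 3 * l / 8) * #J`, more than `S` can hold.
    have hsub : (J.filter fun p => |Z p| ≤ M) ⊆ S := by
      intro p hp
      rw [Finset.mem_filter] at hp
      by_contra hpS
      have h1 := h.ge p hp.1 hpS
      have h2 := abs_sub (Z p) c
      linarith [hp.2]
    have h1 : ((J.filter fun p => |Z p| ≤ M).card : ℝ) ≤ S.card := by
      exact_mod_cast Finset.card_le_card hsub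
    nlinarith
  have hJsplit : ((J.filter fun p => |Z p| ≤ M).card : ℝ) + (J.filter fun p => ¬ |Z p| ≤ M).card
      = J.card := by exact_mod_cast Finset.card_filter_add_card_filter_not _
  have hSsplit : ((S.filter fun p => |Z p| ≤ M).card : ℝ) + (S.filter fun p => ¬ |Z p| ≤ M).card
      = S.card := by exact_mod_cast Finset.card_filter_add_card_filter_not _
  have hout : ((S.filter fun p => ¬ |Z p| ≤ M).card : ℝ) ≤ (J.filter fun p => ¬ |Z p| ≤ M).card := by
    exact_mod_cast Finset.card_le_card (Finset.filter_subset_filter _ h.subset)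
  have hcb := abs_le_of_card_le hM hN hl h.le hρ h.sum_eq_zero (by linarith) (by linarith)
  exact ⟨hcb, by linarith⟩

end TrimmedMean

/-- If the empirical distribution functions are close to the one of a unimodal law, then the
derivative of the score function of the trimmed sample has the correct signs. -/
theorem IsUnimodalDensity.exists_delta {g : ℝ} {f : ℝ → ℝ} {I : Set ℝ}
    (hf : IsUnimodalDensity g f I) {P : Measure ℝ} [IsProbabilityMeasure P]
    (hP : P = volume.withDensity fun y => ENNReal.ofReal (f y)) (hg : 0 < g) {k : ℝ → ℝ}
    (hk : IsOddKernel g k) {l : ℝ} (hl : l ∈ Ioo (0 : ℝ) (1 / 2)) {s t η : ℝ} (hs : s ∈ I)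
    (ht : t ∈ I) (hη : 0 < η) (hηg : η < g) (hηP : P.real (Icc (-η) η) < 1 - l) :
    ∃ δ > 0, ∀ (ι : Type) (J : Finset ι) (Z w : ι → ℝ), J.Nonempty → 1 / (J.card : ℝ) ≤ δ →
      (∀ p ∈ J, 0 ≤ w p) → CDFClose P (weightedEmpirical J (fun _ => 1 / (J.card : ℝ)) Z) δ →
      CDFClose P (weightedEmpirical J w Z) δ → ∀ (c ρ : ℝ) (S : Finset ι),
      IsTrimmedMean J Z l c ρ S → (c - ρ < -η ∧ η < c + ρ) ∧
      (∀ y ∈ Icc s (-η), c - ρ ≤ y → 0 < ∑ p ∈ J with |Z p - c| ≤ ρ, w p * k (y - Z p)) ∧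
      (∀ y ∈ Icc η t, y ≤ c + ρ → ∑ p ∈ J with |Z p - c| ≤ ρ, w p * k (y - Z p) < 0) := by
  classical
  have hnull : NullSingletonClass P := by rw [hP]; infer_instance
  obtain ⟨C, hC0, hC, hC'⟩ := hk.exists_bound
  obtain ⟨M, hM0, hPM⟩ : ∃ M : ℝ, 0 ≤ M ∧ 1 - l / 8 ≤ P.real (Icc (-M) M) := by
    have h1 : Tendsto (fun M : ℕ => P.real (Icc (-(M : ℝ)) M)) atTop (𝓝 (P.real univ)) := by
      have h2 : (⋃ M : ℕ, Icc (-(M : ℝ)) M) = univ := by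
        rw [eq_univ_iff_forall]
        intro x
        obtain ⟨M, hM⟩ := exists_nat_ge |x|
        exact mem_iUnion.2 ⟨M, abs_le.1 hM⟩
      rw [← h2]
      refine (ENNReal.continuousAt_toReal (measure_ne_top _ _)).tendsto.comp
        (tendsto_measure_iUnion_atTop fun m n hmn => ?_)
      have : (m : ℝ) ≤ n := by exact_mod_cast hmn
      exact Icc_subset_Icc (by linarith) this
    rw [probReal_univ] at h1
    obtain ⟨M, hM⟩ := (h1.eventually_const_lt (show 1 - l / 8 < 1 by linarith [hl.1])).exists
    exact ⟨M, Nat.cast_nonneg _, hM.le⟩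
  have hl' : 0 < 1 - 2 * l := by linarith [hl.2]
  set B := M + M / (1 - 2 * l) with hB
  have hB0 : 0 ≤ B := by positivity
  obtain ⟨κ, hκ, hgap⟩ := hf.exists_gap hP hg hk (l := l) (by linarith [hl.2]) hs ht hη hηg hηP B
  -- `A` dominates the coefficients of `δ` in the three errors (mass, first moment, kernel
  -- integral), so each stays within half of the gap `κ`.
  set A := 8 + 10 * B + 2 * (C + C * (2 * B)) with hA
  have hA0 : 0 < A := by positivity
  refine ⟨min (l / 8) (κ / (2 * A)), lt_min (by linarith [hl.1]) (by positivity), ?_⟩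
  intro ι J Z w hJ hN hw hc1 hc2 c ρ S hS
  set δ := min (l / 8) (κ / (2 * A)) with hδ
  have hδ0 : 0 < δ := lt_min (by linarith [hl.1]) (by positivity)
  have hδA : δ * A ≤ κ / 2 := by
    calc δ * A ≤ κ / (2 * A) * A := by gcongr; exact min_le_right _ _
      _ = κ / 2 := by field_simp
  obtain ⟨hcB, hρB⟩ := hS.bounds hl hJ hN (min_le_left _ _) hM0 hPM hc1
  obtain ⟨hG, hΦ⟩ := hS.population hl hJ hN hc1
  have hcB' : |c| ≤ B := hcB.trans (by rw [hB]; linarith)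
  have hρ0 := hS.nonneg
  have hδB : 0 ≤ δ * B := by positivity
  have hδC : 0 ≤ δ * (2 * (C + C * (2 * B))) := by positivity
  have hρδ : ρ * δ ≤ B * δ := by gcongr
  obtain ⟨h1, h2, h3⟩ := hgap c (abs_le.1 hcB') ρ ⟨hρ0, hρB⟩ (by nlinarith) (by nlinarith)
  have hmem : ∀ p, |Z p - c| ≤ ρ ↔ Z p ∈ Icc (c - ρ) (c + ρ) := fun p => by
    rw [abs_le, mem_Icc]; constructor <;> rintro ⟨h1, h2⟩ <;> constructor <;> linarith
  have hclose : ∀ y, |∑ p ∈ J with |Z p - c| ≤ ρ, w p * k (y - Z p) -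
      ∫ z in Icc (c - ρ) (c + ρ), k (y - z) ∂P| ≤ κ / 2 := by
    intro y
    have hd : ∀ z, deriv (fun z => k (y - z)) z = -deriv k (y - z) := fun z => by
      rw [deriv_comp_const_sub]
    have h4 := hc2.abs_setIntegral_sub_le (φ := fun z => k (y - z))
      (hk.contDiff.comp (by fun_prop)) (show c - ρ ≤ c + ρ by linarith) (B := C) (B' := C)
      (hC _) (fun z _ => by rw [hd, abs_neg]; exact hC' _)
    rw [setIntegral_weightedEmpirical hw measurableSet_Icc] at h4
    simp_rw [hmem]
    refine h4.trans (le_trans ?_ hδA)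
    have h5 : C * (c + ρ - (c - ρ)) ≤ C * (2 * B) := by
      apply mul_le_mul_of_nonneg_left _ hC0; linarith
    nlinarith
  refine ⟨h1, fun y hy hcy => ?_, fun y hy hcy => ?_⟩
  · linarith [h2 y hy hcy, (abs_le.1 (hclose y)).1]
  · linarith [h3 y hy hcy, (abs_le.1 (hclose y)).2]

/-! ### Uniform deviation bounds over a Lévy ball -/

theorem continuous_cdf_of_nullSingleton {P : Measure ℝ} [IsProbabilityMeasure P]
    [NullSingletonClass P] : Continuous (ProbabilityTheory.cdf P) := by
  rw [continuous_iff_continuousAt]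
  intro x
  have hmono := ProbabilityTheory.monotone_cdf P
  rw [hmono.continuousAt_iff_leftLim_eq_rightLim, StieltjesFunction.rightLim_eq]
  have h := (ProbabilityTheory.cdf P).measure_singleton x
  rw [ProbabilityTheory.measure_cdf, measure_singleton, eq_comm, ENNReal.ofReal_eq_zero] at h
  exact le_antisymm (hmono.leftLim_le le_rfl) (by linarith)

/-- A finite net of quantiles. -/
theorem exists_quantile_net (P : Measure ℝ) [IsProbabilityMeasure P] [NullSingletonClass P]
    {δ : ℝ} (hδ : 0 < δ) : ∃ τ > 0, ∃ T : Finset ℝ, ∀ y : ℝ,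
      (P.real (Iic y) ≤ δ ∨ ∃ q ∈ T, q + τ < y ∧ P.real (Iic y) ≤ P.real (Iic q) + δ) ∧
      (1 - δ ≤ P.real (Iic y) ∨ ∃ q ∈ T, y < q - τ ∧ P.real (Iic q) ≤ P.real (Iic y) + δ) := by
  classical
  simp_rw [← ProbabilityTheory.cdf_eq_real]
  set F := ProbabilityTheory.cdf P with hF
  have hmono : Monotone F := ProbabilityTheory.monotone_cdf P
  -- The net consists of the quantiles of levels `i / K`. Moving two levels away costs less than `δ`
  -- in probability and leaves a full gap between consecutive quantiles, which exceeds `τ`.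
  obtain ⟨K, hK⟩ := exists_nat_gt (3 / δ)
  have hK0 : (0 : ℝ) < K := lt_trans (by positivity) hK
  have hKδ : 3 < δ * K := by rwa [div_lt_iff₀' hδ] at hK
  have hq : ∀ i : ℕ, ∃ q : ℝ, 0 < i → i < K → F q = i / K := by
    intro i
    by_cases h0 : 0 < i
    swap
    · exact ⟨0, fun h => absurd h h0⟩
    by_cases hiK : i < K
    swap
    · exact ⟨0, fun _ h => absurd h hiK⟩
    have h1 : (0 : ℝ) < i / K := div_pos (by exact_mod_cast h0) hK0
    have h2 : (i : ℝ) / K < 1 := (div_lt_one hK0).2 (by exact_mod_cast hiK)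
    obtain ⟨q, hq⟩ := mem_range_of_exists_le_of_exists_ge
      (continuous_cdf_of_nullSingleton (P := P))
      ((ProbabilityTheory.tendsto_cdf_atBot P).eventually_le_const h1).exists
      ((ProbabilityTheory.tendsto_cdf_atTop P).eventually_const_le h2).exists
    exact ⟨q, fun _ _ => hq⟩
  choose q hq using hq
  have hlt : ∀ i ∈ Finset.Ico 1 (K - 1), 0 < q (i + 1) - q i := by
    intro i hi
    rw [Finset.mem_Ico] at hi
    rw [sub_pos]
    apply hmono.reflect_lt
    rw [hq i (by omega) (by omega), hq (i + 1) (by omega) (by omega)]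
    push_cast
    gcongr
    linarith
  obtain ⟨τ, hτ, hτ0⟩ : ∃ τ : ℝ, (∀ i ∈ Finset.Ico 1 (K - 1), τ < q (i + 1) - q i) ∧ 0 < τ := by
    have h1 : ∀ᶠ τ in 𝓝[>] (0 : ℝ), ∀ i ∈ Finset.Ico 1 (K - 1), τ < q (i + 1) - q i := by
      rw [Filter.eventually_all_finset]
      intro i hi
      exact nhdsWithin_le_nhds (eventually_lt_nhds (hlt i hi))
    exact (h1.and self_mem_nhdsWithin).exists
  refine ⟨τ, hτ0, (Finset.Ico 1 K).image q, fun y => ⟨?_, ?_⟩⟩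
  · rcases le_or_gt (F y) δ with h | h
    · exact Or.inl h
    right
    have h3 : 3 < F y * K := hKδ.trans (by gcongr)
    have hle : F y * K ≤ K := by nlinarith [ProbabilityTheory.cdf_le_one P y]
    have hc1 := Nat.ceil_lt_add_one (show 0 ≤ F y * K by linarith)
    have hc2 := Nat.le_ceil (F y * K)
    have hc3 : ⌈F y * K⌉₊ ≤ K := Nat.ceil_le.2 hle
    have hc4 : 3 < ⌈F y * K⌉₊ := by exact_mod_cast h3.trans_le hc2
    obtain ⟨i, hi⟩ : ∃ i, ⌈F y * K⌉₊ = i + 2 := ⟨⌈F y * K⌉₊ - 2, by omega⟩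
    rw [hi] at hc1 hc2
    push_cast at hc1 hc2
    have h5 := hτ i (Finset.mem_Ico.2 (by omega))
    have h6 : q (i + 1) < y := by
      apply hmono.reflect_lt
      rw [hq (i + 1) (by omega) (by omega), div_lt_iff₀ hK0]
      push_cast
      linarith
    refine ⟨q i, Finset.mem_image_of_mem _ (Finset.mem_Ico.2 (by omega)), by linarith, ?_⟩
    rw [hq i (by omega) (by omega), div_add' _ _ _ hK0.ne', le_div_iff₀ hK0]
    linarith
  · rcases le_or_gt (1 - δ) (F y) with h | h
    · exact Or.inl h
    right
    have h0 : 0 ≤ F y * K := mul_nonneg (ProbabilityTheory.cdf_nonneg P y) hK0.le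
    have h3 : F y * K < K - 3 := by nlinarith
    have hc1 := Nat.lt_floor_add_one (F y * K)
    have hc2 := Nat.floor_le h0
    have hc3 : ⌊F y * K⌋₊ + 3 < K := by
      have : (⌊F y * K⌋₊ : ℝ) + 3 < K := by linarith
      exact_mod_cast this
    have h5 := hτ (⌊F y * K⌋₊ + 1) (Finset.mem_Ico.2 (by omega))
    have h6 : y < q (⌊F y * K⌋₊ + 1) := by
      apply hmono.reflect_lt
      rw [hq _ (by omega) (by omega), lt_div_iff₀ hK0]
      push_cast
      linarith
    refine ⟨q (⌊F y * K⌋₊ + 1 + 1), Finset.mem_image_of_mem _ (Finset.mem_Ico.2 (by omega)),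
      by linarith, ?_⟩
    rw [hq _ (by omega) (by omega), div_le_iff₀ hK0]
    push_cast
    linarith

/-- `Q` is in the Lévy ball of radius `e` around `P`. -/
def LevyClose (P Q : Measure ℝ) (e : ℝ) : Prop :=
  ∀ y : ℝ, P.real (Iic (y - e)) - e ≤ Q.real (Iic y) ∧
    Q.real (Iic y) ≤ P.real (Iic (y + e)) + e

/-- The three units of `δ` pay for the net, the vertical Lévy error and the sampling deviation. The
horizontal slack `τ` of the net pays for the Lévy shift and the displacement of `Z` from `ε`, at
most `τ / 4` each, which is why deviations are needed only at `q ± τ / 4`. -/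
theorem cdfClose_of_net {P Q : Measure ℝ} [IsProbabilityMeasure P] {δ τ e : ℝ}
    {T : Finset ℝ} (hT : ∀ y : ℝ,
      (P.real (Iic y) ≤ δ ∨ ∃ q ∈ T, q + τ < y ∧ P.real (Iic y) ≤ P.real (Iic q) + δ) ∧
      (1 - δ ≤ P.real (Iic y) ∨ ∃ q ∈ T, y < q - τ ∧ P.real (Iic q) ≤ P.real (Iic y) + δ))
    (hPQ : LevyClose P Q e) (heδ : e ≤ δ) (heτ : e ≤ τ / 4) (hδ : 0 ≤ δ)
    {ι : Type} {J : Finset ι} {w Z ε : ι → ℝ} (hw : ∀ p ∈ J, 0 ≤ w p) (hw1 : ∑ p ∈ J, w p = 1)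
    (hZ : ∀ p ∈ J, |Z p - ε p| ≤ τ / 4)
    (hdev : ∀ q ∈ T, ∀ u ∈ ({q + τ / 4, q - τ / 4} : Set ℝ),
      |(weightedEmpirical J w ε).real (Iic u) - Q.real (Iic u)| < δ) :
    CDFClose P (weightedEmpirical J w Z) (3 * δ) := by
  classical
  have hcomp : ∀ {A A' : Set ℝ}, MeasurableSet A → MeasurableSet A' → ∀ {X X' : ι → ℝ},
      (∀ p ∈ J, X p ∈ A → X' p ∈ A') →
      (weightedEmpirical J w X).real A ≤ (weightedEmpirical J w X').real A' := by
    intro A A' hA hA' X X' h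
    rw [weightedEmpirical_real hw hA, weightedEmpirical_real hw hA']
    refine Finset.sum_le_sum_of_subset_of_nonneg (fun p hp => ?_) fun p hp _ =>
      hw p (Finset.mem_filter.1 hp).1
    rw [Finset.mem_filter] at hp ⊢
    exact ⟨hp.1, h p hp.1 hp.2⟩
  have hP1 : ∀ {u v : ℝ}, u ≤ v → P.real (Iic u) ≤ P.real (Iic v) := fun h =>
    measureReal_mono (Iic_subset_Iic.2 h)
  intro y
  constructor
  · rcases (hT y).1 with h | ⟨q, hq, hqy, hle⟩
    · have := measureReal_nonneg (μ := weightedEmpirical J w Z) (s := Iio y)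
      linarith
    · have h1 := (abs_lt.1 (hdev q hq (q + τ / 4) (Or.inl rfl))).1
      have h2 := (hPQ (q + τ / 4)).1
      have h3 := hP1 (show q ≤ q + τ / 4 - e by linarith)
      have h4 : (weightedEmpirical J w ε).real (Iic (q + τ / 4))
          ≤ (weightedEmpirical J w Z).real (Iio y) := by
        refine hcomp measurableSet_Iic measurableSet_Iio fun p hp hpε => ?_
        have h5 := abs_le.1 (hZ p hp)
        rw [mem_Iic] at hpε
        rw [mem_Iio]
        have : 0 ≤ τ / 4 := (abs_nonneg _).trans (hZ p hp)
        linarith [h5.2]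
      linarith
  · rcases (hT y).2 with h | ⟨q, hq, hqy, hle⟩
    · have : (weightedEmpirical J w Z).real (Iic y) ≤ 1 := by
        rw [weightedEmpirical_real hw measurableSet_Iic, ← hw1]
        exact Finset.sum_le_sum_of_subset_of_nonneg (Finset.filter_subset _ _) fun p hp _ => hw p hp
      linarith
    · have h1 := (abs_lt.1 (hdev q hq (q - τ / 4) (Or.inr rfl))).2
      have h2 := (hPQ (q - τ / 4)).2
      have h3 := hP1 (show q - τ / 4 + e ≤ q by linarith)
      have h4 : (weightedEmpirical J w Z).real (Iic y)
          ≤ (weightedEmpirical J w ε).real (Iic (q - τ / 4)) := by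
        refine hcomp measurableSet_Iic measurableSet_Iic fun p hp hpε => ?_
        have h5 := abs_le.1 (hZ p hp)
        rw [mem_Iic] at hpε ⊢
        have : 0 ≤ τ / 4 := (abs_nonneg _).trans (hZ p hp)
        linarith [h5.1]
      linarith

/-- Chebyshev's inequality for weighted empirical measures. -/
theorem measure_weightedEmpirical_sub_ge_le {ι : Type} [Fintype ι] (Q : Measure ℝ)
    [IsProbabilityMeasure Q] {J : Finset ι} {w : ι → ℝ} {β : ℝ} (hw : ∀ p ∈ J, 0 ≤ w p)
    (hw1 : ∑ p ∈ J, w p = 1) (hβ : ∀ p ∈ J, w p ≤ β) {A : Set ℝ} (hA : MeasurableSet A) {δ : ℝ}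
    (hδ : 0 < δ) :
    (Measure.pi fun _ : ι => Q) {ε | δ ≤ |(weightedEmpirical J w ε).real A - Q.real A|} ≤
      ENNReal.ofReal (β / δ ^ 2) := by
  classical
  let X : ι → ℝ → ℝ := fun p z => if p ∈ J then w p * A.indicator (fun _ => 1) z else 0
  have hXm : ∀ p, Measurable (X p) := fun p => by
    simp only [X]
    split_ifs
    · exact (measurable_const.indicator hA).const_mul _
    · exact measurable_const
  have hXb : ∀ p z, X p z ∈ Icc 0 (if p ∈ J then w p else 0) := fun p z => by
    simp only [X]
    split_ifs with hp
    · by_cases hz : z ∈ A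
      · simp [hz, hw p hp]
      · simp [hz, hw p hp]
    · simp
  have hXL : ∀ p, MemLp (X p) 2 Q := fun p =>
    MemLp.of_bound (hXm p).aestronglyMeasurable (if p ∈ J then w p else 0) (ae_of_all _ fun z => by
      rw [Real.norm_of_nonneg (hXb p z).1]; exact (hXb p z).2)
  have hsum : ∀ ε : ι → ℝ, (∑ p, fun ω : ι → ℝ => X p (ω p)) ε
      = (weightedEmpirical J w ε).real A := fun ε => by
    rw [weightedEmpirical_real hw hA, Finset.sum_apply, Finset.sum_filter]
    simp only [X, indicator]
    rw [Finset.sum_ite_mem, Finset.univ_inter]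
    exact Finset.sum_congr rfl fun p _ => by split_ifs <;> simp
  have hL2 : MemLp (∑ p, fun ω : ι → ℝ => X p (ω p)) 2 (Measure.pi fun _ : ι => Q) :=
    memLp_finsetSum' _ fun p _ => (hXL p).comp_measurePreserving (measurePreserving_eval _ p)
  have hmean : (∫ ε, (∑ p, fun ω : ι → ℝ => X p (ω p)) ε ∂(Measure.pi fun _ : ι => Q))
      = Q.real A := by
    simp only [Finset.sum_apply]
    have hint : ∀ p, Integrable (fun ε : ι → ℝ => X p (ε p)) (Measure.pi fun _ : ι => Q) :=
      fun p => ((hXL p).comp_measurePreserving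
        (measurePreserving_eval (fun _ : ι => Q) p)).integrable one_le_two
    rw [integral_finsetSum _ fun p _ => hint p]
    have h1 : ∀ p, ∫ ε : ι → ℝ, X p (ε p) ∂(Measure.pi fun _ : ι => Q)
        = if p ∈ J then w p * Q.real A else 0 := fun p => by
      rw [integral_comp_eval (μ := fun _ : ι => Q) (hXm p).aestronglyMeasurable]
      simp only [X]
      split_ifs
      · rw [integral_const_mul, integral_indicator hA]; simp
      · simp
    simp_rw [h1]
    rw [Finset.sum_ite_mem, Finset.univ_inter, ← Finset.sum_mul, hw1, one_mul]
  have hvar : ProbabilityTheory.variance (∑ p, fun ω : ι → ℝ => X p (ω p))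
      (Measure.pi fun _ : ι => Q) ≤ β := by
    rw [ProbabilityTheory.variance_sum_pi hXL]
    calc ∑ p, ProbabilityTheory.variance (X p) Q ≤ ∑ p, if p ∈ J then w p * β else 0 := by
          refine Finset.sum_le_sum fun p _ => ?_
          -- A variable with values in `[0, w p]` has variance at most `(w p / 2) ^ 2 ≤ w p * β`;
          -- since the weights sum to one, the total is at most `β`.
          refine (ProbabilityTheory.variance_le_sq_of_bounded (ae_of_all _ (hXb p))
            (hXm p).aemeasurable).trans ?_
          split_ifs with hp
          · nlinarith [hw p hp, hβ p hp]
          · simp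
      _ = β := by rw [Finset.sum_ite_mem, Finset.univ_inter, ← Finset.sum_mul, hw1, one_mul]
  have hcheb := ProbabilityTheory.meas_ge_le_variance_div_sq hL2 hδ
  rw [hmean] at hcheb
  simp_rw [hsum] at hcheb
  exact hcheb.trans (ENNReal.ofReal_le_ofReal (by gcongr))

/-- The weighted empirical distribution function of almost i.i.d. observations, the law of which is
in a small Lévy ball around `P`, is close to the distribution function of `P` with high
probability. -/
theorem exists_measure_not_cdfClose_le (P : Measure ℝ) [IsProbabilityMeasure P]
    [NullSingletonClass P] {δ : ℝ} (hδ : 0 < δ) :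
    ∃ τ > 0, ∃ C : ℝ, 0 ≤ C ∧ ∀ Q : Measure ℝ, IsProbabilityMeasure Q → LevyClose P Q τ →
      ∀ (ι : Type) [Fintype ι] (J : Finset ι) (w : ι → ℝ) (β : ℝ), (∀ p ∈ J, 0 ≤ w p) →
        ∑ p ∈ J, w p = 1 → (∀ p ∈ J, w p ≤ β) →
        (Measure.pi fun _ : ι => Q) {ε | ∃ Z : ι → ℝ, (∀ p ∈ J, |Z p - ε p| ≤ τ) ∧
          ¬ CDFClose P (weightedEmpirical J w Z) δ} ≤ ENNReal.ofReal (C * β) := by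
  classical
  obtain ⟨τ, hτ, T, hT⟩ := exists_quantile_net P (show 0 < δ / 3 by positivity)
  let U : Finset ℝ := T.image (fun q => q + τ / 4) ∪ T.image (fun q => q - τ / 4)
  refine ⟨min (δ / 3) (τ / 4), by positivity, U.card * (1 / (δ / 3) ^ 2), by positivity, ?_⟩
  intro Q hQ hPQ ι _ J w β hw hw1 hβ
  have hsub : {ε : ι → ℝ | ∃ Z : ι → ℝ, (∀ p ∈ J, |Z p - ε p| ≤ min (δ / 3) (τ / 4)) ∧
      ¬ CDFClose P (weightedEmpirical J w Z) δ} ⊆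
      ⋃ u ∈ U, {ε | δ / 3 ≤ |(weightedEmpirical J w ε).real (Iic u) - Q.real (Iic u)|} := by
    rintro ε ⟨Z, hZ, hnot⟩
    by_contra hcon
    simp only [mem_iUnion, mem_ofPred_eq, not_exists, not_le] at hcon
    apply hnot
    have := cdfClose_of_net hT hPQ (min_le_left _ _) (min_le_right _ _) (by positivity) hw hw1
      (fun p hp => (hZ p hp).trans (min_le_right _ _)) (fun q hq u hu => hcon u (by
        rcases hu with rfl | rfl
        · exact Finset.mem_union_left _ (Finset.mem_image_of_mem _ hq)
        · exact Finset.mem_union_right _ (Finset.mem_image_of_mem (fun q => q - τ / 4) hq)))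
    rwa [show 3 * (δ / 3) = δ by ring] at this
  calc _ ≤ _ := measure_mono hsub
    _ ≤ ∑ u ∈ U, _ := measure_biUnion_finset_le _ _
    _ ≤ ∑ u ∈ U, ENNReal.ofReal (β / (δ / 3) ^ 2) := Finset.sum_le_sum fun u _ =>
        measure_weightedEmpirical_sub_ge_le Q hw hw1 hβ measurableSet_Iic (by positivity)
    _ = ENNReal.ofReal (U.card * (1 / (δ / 3) ^ 2) * β) := by
        rw [Finset.sum_const, nsmul_eq_mul, ← ENNReal.ofReal_natCast,
          ← ENNReal.ofReal_mul (Nat.cast_nonneg _)]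
        congr 1
        ring

/-! ### Modes next to a starting value -/

/-- The signs of the derivative at the endpoints keep the maximum over `[a, b]` in the interior, and
its value is positive because it strictly exceeds `H a ≥ 0`. -/
theorem exists_isLocalMax_of_deriv {H : ℝ → ℝ} (hH : Differentiable ℝ H) (hnn : ∀ y, 0 ≤ H y)
    {a b : ℝ} (hab : a < b) (ha : 0 < deriv H a) (hb : deriv H b < 0) :
    ∃ y ∈ Ioo a b, IsLocalMax H y ∧ 0 < H y := by
  obtain ⟨y, hy, hmax⟩ := isCompact_Icc.exists_isMaxOn (nonempty_Icc.2 hab.le)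
    hH.continuous.continuousOn
  have hright : ∀ᶠ z in 𝓝[>] a, H a < H z := by
    have h1 := (hasDerivAt_iff_tendsto_slope.1 (hH a).hasDerivAt).eventually_const_lt ha
    have h2 := h1.filter_mono (nhdsWithin_mono a (fun z (hz : a < z) => hz.ne'))
    filter_upwards [h2, self_mem_nhdsWithin] with z hz hza
    rw [slope_def_field, div_pos_iff_of_pos_right (sub_pos.2 hza)] at hz
    linarith
  have hleft : ∀ᶠ z in 𝓝[<] b, H b < H z := by
    have h1 := (hasDerivAt_iff_tendsto_slope.1 (hH b).hasDerivAt).eventually_lt_const hb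
    have h2 := h1.filter_mono (nhdsWithin_mono b (fun z (hz : z < b) => hz.ne))
    filter_upwards [h2, self_mem_nhdsWithin] with z hz hzb
    rw [slope_def_field, div_neg_iff] at hz
    have : z - b < 0 := sub_neg.2 hzb
    rcases hz with hz | hz <;> linarith [hz.1, hz.2]
  have hya : H a < H y := by
    obtain ⟨z, hz, hzI⟩ := (hright.and (Ioo_mem_nhdsGT hab)).exists
    exact hz.trans_le (hmax (Ioo_subset_Icc_self hzI))
  have hyb : H b < H y := by
    obtain ⟨z, hz, hzI⟩ := (hleft.and (Ioo_mem_nhdsLT hab)).exists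
    exact hz.trans_le (hmax (Ioo_subset_Icc_self hzI))
  have hyI : y ∈ Ioo a b := ⟨lt_of_le_of_ne hy.1 (by rintro rfl; exact lt_irrefl _ hya),
    lt_of_le_of_ne hy.2 (by rintro rfl; exact lt_irrefl _ hyb)⟩
  exact ⟨y, hyI, hmax.isLocalMax (Icc_mem_nhds hyI.1 hyI.2), (hnn a).trans_lt hya⟩

/-- The admissible modes are nonempty, and the one next to the starting value is close to `m`. -/
theorem admissibleModes_near {H : ℝ → ℝ} (hH : Differentiable ℝ H) (hnn : ∀ y, 0 ≤ H y)
    {m s t η a b y₀ : ℝ} (hη : 0 < η) (has : a < m - η) (hbt : m + η < b)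
    (hs : s ≤ m - η) (ht : m + η ≤ t)
    (hleft : ∀ y, y < a → 0 ≤ deriv H y ∧ (0 < H y → 0 < deriv H y))
    (hright : ∀ y, b < y → deriv H y ≤ 0 ∧ (0 < H y → deriv H y < 0))
    (hpos : ∀ y ∈ Icc s (m - η), a ≤ y → 0 < deriv H y)
    (hneg : ∀ y ∈ Icc (m + η) t, y ≤ b → deriv H y < 0) (hy₀ : y₀ ∈ Icc s t) :
    (admissibleModes H y₀).Nonempty ∧ ∀ v ∈ closure (admissibleModes H y₀),
      (∀ w ∈ closure (admissibleModes H y₀), |v - y₀| ≤ |w - y₀|) → |v - m| ≤ 3 * η := by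
  have h1 : 0 < deriv H (m - η) := hpos _ ⟨hs, le_rfl⟩ has.le
  have h2 : deriv H (m + η) < 0 := hneg _ ⟨le_rfl, ht⟩ hbt.le
  obtain ⟨y, hy, hymax, hyH⟩ := exists_isLocalMax_of_deriv hH hnn (by linarith) h1 h2
  have hcrit : ∀ v ∈ admissibleModes H y₀, (s ≤ v → m - η ≤ v) ∧ a ≤ v ∧ (v ≤ t → v ≤ m + η) ∧
      v ≤ b := by
    intro v hv
    have hd : deriv H v = 0 := hv.1.deriv_eq_zero
    have ha : a ≤ v := by
      by_contra! h
      exact absurd hd ((hleft v h).2 hv.2.1).ne'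
    have hb : v ≤ b := by
      by_contra! h
      exact absurd hd ((hright v h).2 hv.2.1).ne
    refine ⟨fun h => ?_, ha, fun h => ?_, hb⟩
    · by_contra! h'
      exact absurd hd (hpos v ⟨h, h'.le⟩ ha).ne'
    · by_contra! h'
      exact absurd hd (hneg v ⟨h'.le, h⟩ hb).ne
  rcases lt_or_ge y₀ (m - η) with hlt | hge
  · have hd : 0 ≤ deriv H y₀ := by
      rcases lt_or_ge y₀ a with h | h
      · exact (hleft y₀ h).1
      · exact (hpos y₀ ⟨hy₀.1, hlt.le⟩ h).le
    have hyA : y ∈ admissibleModes H y₀ :=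
      ⟨hymax, hyH, fun h => absurd h (not_lt.2 hd), fun _ => hlt.trans hy.1⟩
    refine ⟨⟨y, hyA⟩, fun v hv hmin => ?_⟩
    -- Modes avoid `[s, m - η)`, so `s ≤ v` suffices. Either `y₀ < a`, and all modes are at least
    -- `a`, or the derivative at `y₀` is positive and admissibility gives `y₀ < v`.
    have hsub : admissibleModes H y₀ ⊆ Ici (m - η) := by
      intro v hv
      obtain ⟨hv1, hv2, -⟩ := hcrit v hv
      apply hv1
      rcases lt_or_ge y₀ a with h | h
      · linarith [hy₀.1]
      · linarith [hv.2.2.2 (hpos y₀ ⟨hy₀.1, hlt.le⟩ h), hy₀.1]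
    have hvm : m - η ≤ v := closure_minimal hsub isClosed_Ici hv
    have h3 := hmin y (subset_closure hyA)
    rw [abs_of_pos (by linarith), abs_of_pos (by linarith [hy.1])] at h3
    rw [abs_le]
    constructor <;> linarith [hy.2]
  rcases lt_or_ge (m + η) y₀ with hgt | hle
  · have hd : deriv H y₀ ≤ 0 := by
      rcases lt_or_ge b y₀ with h | h
      · exact (hright y₀ h).1
      · exact (hneg y₀ ⟨hgt.le, hy₀.2⟩ h).le
    have hyA : y ∈ admissibleModes H y₀ :=
      ⟨hymax, hyH, fun _ => hy.2.trans hgt, fun h => absurd h (not_lt.2 hd)⟩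
    refine ⟨⟨y, hyA⟩, fun v hv hmin => ?_⟩
    have hsub : admissibleModes H y₀ ⊆ Iic (m + η) := by
      intro v hv
      obtain ⟨-, -, hv1, hv2⟩ := hcrit v hv
      apply hv1
      rcases lt_or_ge b y₀ with h | h
      · linarith [hy₀.2]
      · linarith [hv.2.2.1 (hneg y₀ ⟨hgt.le, hy₀.2⟩ h), hy₀.2]
    have hvm : v ≤ m + η := closure_minimal hsub isClosed_Iic hv
    have h3 := hmin y (subset_closure hyA)
    rw [abs_of_neg (by linarith), abs_of_neg (by linarith [hy.2])] at h3
    rw [abs_le]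
    constructor <;> linarith [hy.1]
  -- A start within `η` of `m` leads, in each possible direction of ascent, to an admissible mode in
  -- the same interval. The nearest one is then at distance at most `2 * η` from `y₀`.
  · obtain ⟨z, hzA, hz⟩ : ∃ z ∈ admissibleModes H y₀, z ∈ Icc (m - η) (m + η) := by
      rcases lt_trichotomy (deriv H y₀) 0 with h | h | h
      · have hne : m - η < y₀ := lt_of_le_of_ne hge (by rintro rfl; linarith)
        obtain ⟨z, hz, hzmax, hzH⟩ := exists_isLocalMax_of_deriv hH hnn hne h1 h
        exact ⟨z, ⟨hzmax, hzH, fun _ => hz.2, fun h' => by linarith⟩, hz.1.le, by linarith [hz.2]⟩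
      · exact ⟨y, ⟨hymax, hyH, fun h' => by linarith, fun h' => by linarith⟩, hy.1.le, hy.2.le⟩
      · have hne : y₀ < m + η := lt_of_le_of_ne hle (by rintro rfl; linarith)
        obtain ⟨z, hz, hzmax, hzH⟩ := exists_isLocalMax_of_deriv hH hnn hne h h2
        exact ⟨z, ⟨hzmax, hzH, fun h' => by linarith, fun _ => hz.1⟩, by linarith [hz.1], hz.2.le⟩
    refine ⟨⟨z, hzA⟩, fun v _ hmin => ?_⟩
    have h3 := hmin z (subset_closure hzA)
    have h4 : |z - y₀| ≤ 2 * η := abs_le.2 ⟨by linarith [hz.1], by linarith [hz.2]⟩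
    have h5 := abs_le.1 (h3.trans h4)
    rw [abs_le]
    constructor <;> linarith [h5.1, h5.2]

/-! ### The centre of the window -/

theorem norm_sub_designPoint_sq (n : ℕ) (x : Plane) (p : Fin n × Fin n) :
    ‖x - designPoint n p‖ ^ 2 =
      (x 0 - ((p.1 : ℝ) + 1 / 2) / n) ^ 2 + (x 1 - ((p.2 : ℝ) + 1 / 2) / n) ^ 2 := by
  rw [EuclideanSpace.norm_sq_eq, Fin.sum_univ_two]
  simp [designPoint]

/-- The squared distance is a sum over the coordinates, so minimization and tie-breaking can be done
in each coordinate separately. -/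
theorem exists_isCentre {n : ℕ} (hn : 0 < n) (x : Plane) : ∃ p, IsCentre n x p := by
  have : Nonempty (Fin n) := ⟨⟨0, hn⟩⟩
  have key : ∀ φ : Fin n → ℝ, ∃ i, (∀ j, φ i ≤ φ j) ∧ ∀ j, φ j = φ i → i ≤ j := by
    intro φ
    obtain ⟨i₀, hi₀⟩ := Finite.exists_min φ
    obtain ⟨i, hi, hmin⟩ := (Finset.univ.filter fun i => φ i = φ i₀).exists_min_image id
      ⟨i₀, by simp⟩
    rw [Finset.mem_filter] at hi
    exact ⟨i, fun j => hi.2 ▸ hi₀ j, fun j hj => hmin j (by simp [hj, hi.2])⟩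
  obtain ⟨i, hi1, hi2⟩ := key fun i => (x 0 - ((i : ℝ) + 1 / 2) / n) ^ 2
  obtain ⟨j, hj1, hj2⟩ := key fun i => (x 1 - ((i : ℝ) + 1 / 2) / n) ^ 2
  refine ⟨(i, j), fun q => ?_, fun q hq => ?_⟩
  · rw [← sq_le_sq₀ (norm_nonneg _) (norm_nonneg _), norm_sub_designPoint_sq,
      norm_sub_designPoint_sq]
    exact add_le_add (hi1 q.1) (hj1 q.2)
  · have h := congrArg (· ^ 2) hq
    simp only [norm_sub_designPoint_sq] at h
    have h1 := hi1 q.1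
    have h2 := hj1 q.2
    exact ⟨hi2 q.1 (by linarith), hj2 q.2 (by linarith)⟩

theorem IsCentre.unique {n : ℕ} {x : Plane} {p q : Fin n × Fin n} (hp : IsCentre n x p)
    (hq : IsCentre n x q) : p = q := by
  have h : ‖x - designPoint n p‖ = ‖x - designPoint n q‖ := le_antisymm (hp.1 q) (hq.1 p)
  have h1 := hp.2 q h.symm
  have h2 := hq.2 p h
  exact Prod.ext (le_antisymm h1.1 h2.1) (le_antisymm h1.2 h2.2)

/-- The set of modes need not be closed; passing to its closure makes the minimal distance to the
starting value attained. -/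
theorem exists_isTMValue {K : Plane → ℝ} {L : ℝ → ℝ} {g h l : ℝ} {n : ℕ} {x : Plane}
    {Y : Fin n × Fin n → ℝ} {p₀ : Fin n × Fin n} {c : ℝ} (hp₀ : IsCentre n x p₀)
    (hc : IsLTSValue h l n x Y c)
    (hne : (admissibleModes (scoreFunction K L g h n x (retained h l n x Y c) Y)
      (Y p₀)).Nonempty) : ∃ v, IsTMValue K L g h l n x Y v := by
  obtain ⟨v, hv, hdist⟩ := isClosed_closure.exists_infDist_eq_dist hne.closure (Y p₀)
  refine ⟨v, p₀, c, hp₀, hc, hv, fun w hw => ?_⟩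
  have := Metric.infDist_le_dist_of_mem (x := Y p₀) hw
  rw [hdist, dist_comm, dist_comm _ w, Real.dist_eq, Real.dist_eq] at this
  exact this

/-! ### Counting pixels -/

/-- A diagonal run of `M` pixels starting at the cell of `x` fits into the window because `n * h n →
∞`, and into the grid because `x k < 1`. -/
theorem eventually_le_card_window {h : ℕ → ℝ} (hh : IsBandwidth h) {x : Plane}
    (hx : x ∈ openUnitSquare) {θ : ℝ} (hθ : 0 < θ) (M : ℕ) :
    ∀ᶠ n : ℕ in atTop, M ≤ (window (θ * h n) n x).card := by
  have h1 : ∀ᶠ n : ℕ in atTop, (n : ℝ)⁻¹ * (h n)⁻¹ < θ / (M + 1) :=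
    hh.tendsto_inv.eventually_lt_const (by positivity)
  have h2 : ∀ k : Fin 2, ∀ᶠ n : ℕ in atTop, (M : ℝ) < n * (1 - x k) := fun k =>
    (tendsto_natCast_atTop_atTop.atTop_mul_const (by linarith [(hx k).2])).eventually_gt_atTop _
  filter_upwards [h1, h2 0, h2 1, eventually_gt_atTop 0] with n h1 h20 h21 hn
  have hn' : (0 : ℝ) < n := by exact_mod_cast hn
  have hhn := hh.pos n
  have hM1 : (M : ℝ) + 1 < n * (θ * h n) := by
    rw [← mul_inv, lt_div_iff₀ (by positivity), inv_mul_lt_iff₀ (by positivity)] at h1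
    linarith
  have hfl : ∀ k : Fin 2, (⌊n * x k⌋₊ : ℝ) ≤ n * x k ∧ n * x k < ⌊n * x k⌋₊ + 1 := fun k =>
    ⟨Nat.floor_le (mul_nonneg hn'.le (hx k).1.le), Nat.lt_floor_add_one _⟩
  have hlt : ∀ k : Fin 2, (M : ℝ) < n * (1 - x k) → ∀ j : Fin M, ⌊n * x k⌋₊ + j < n := by
    intro k hk j
    have hj : (j : ℝ) < M := by exact_mod_cast j.2
    have : (⌊n * x k⌋₊ : ℝ) + j < n := by linarith [(hfl k).1]
    exact_mod_cast this
  have hnear : ∀ k : Fin 2, ∀ j : Fin M,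
      |x k - (((⌊n * x k⌋₊ + j : ℕ) : ℝ) + 1 / 2) / n| ≤ θ * h n := by
    intro k j
    have hj : (j : ℝ) < M := by exact_mod_cast j.2
    have hj0 : (0 : ℝ) ≤ j := Nat.cast_nonneg _
    have : x k - (((⌊n * x k⌋₊ + j : ℕ) : ℝ) + 1 / 2) / n =
        (n * x k - (⌊n * x k⌋₊ + j + 1 / 2)) / n := by
      push_cast
      field_simp
    rw [this, abs_div, abs_of_pos hn', div_le_iff₀ hn', abs_le]
    constructor <;> linarith [(hfl k).1, (hfl k).2]
  let emb : Fin M ↪ Fin n × Fin n :=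
    ⟨fun j => (⟨⌊n * x 0⌋₊ + j, hlt 0 h20 j⟩, ⟨⌊n * x 1⌋₊ + j, hlt 1 h21 j⟩), fun i j hij => by
      simpa [Fin.ext_iff] using hij⟩
  calc M = (Finset.univ.map emb).card := by simp
    _ ≤ _ := Finset.card_le_card fun p hp => by
      obtain ⟨j, -, rfl⟩ := Finset.mem_map.1 hp
      refine Finset.mem_filter.2 ⟨Finset.mem_univ _, fun k => ?_⟩
      fin_cases k
      · exact hnear 0 j
      · exact hnear 1 j

/-! ### Properties of the kernels -/

theorem plane_norm_le {u : Plane} {a : ℝ} (hu : ∀ k, |u k| ≤ a) : ‖u‖ ≤ 2 * a := by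
  have ha : 0 ≤ a := (abs_nonneg _).trans (hu 0)
  apply le_of_sq_le_sq _ (by positivity)
  rw [EuclideanSpace.norm_sq_eq, Fin.sum_univ_two]
  simp only [Real.norm_eq_abs]
  nlinarith [hu 0, hu 1, abs_nonneg (u 0), abs_nonneg (u 1)]

namespace IsSpatialKernel

variable {K : Plane → ℝ} (hK : IsSpatialKernel K)
include hK

theorem nonneg' (u : Plane) : 0 ≤ K u := by
  by_cases hu : ∀ k, u k ∈ Ioo (-1 : ℝ) 1
  · exact hK.nonneg u hu
  · exact (hK.eq_zero u hu).ge

theorem exists_le : ∃ B, 0 < B ∧ ∀ u, K u ≤ B := by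
  obtain ⟨C, hC⟩ := hK.lipschitz
  refine ⟨K 0 + C * 2, by have := hK.pos_zero; positivity, fun u => ?_⟩
  by_cases hu : ∀ k, u k ∈ Ioo (-1 : ℝ) 1
  · have h1 := hC.dist_le_mul u 0
    rw [Real.dist_eq, dist_zero_right] at h1
    have h2 : ‖u‖ ≤ 2 * 1 := plane_norm_le fun k => abs_le.2 ⟨(hu k).1.le, (hu k).2.le⟩
    have h3 : (C : ℝ) * ‖u‖ ≤ C * 2 := by gcongr; linarith
    linarith [le_abs_self (K u - K 0)]
  · rw [hK.eq_zero u hu]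
    have := hK.pos_zero
    positivity

/-- Makes the total kernel weight at least `K 0 / 2` times the number of pixels in a smaller window,
so that no single normalized weight matters in the limit. -/
theorem exists_ge : ∃ θ, 0 < θ ∧ θ < 1 ∧ ∀ u : Plane, (∀ k, |u k| ≤ θ) → K 0 / 2 ≤ K u := by
  obtain ⟨C, hC⟩ := hK.lipschitz
  have h0 := hK.pos_zero
  obtain ⟨r, hr, hball⟩ := Metric.continuousAt_iff.1 (hC.continuous.continuousAt (x := 0))
    (K 0 / 2) (by positivity)
  refine ⟨min (1 / 2) (r / 4), by positivity, (min_le_left _ _).trans_lt (by norm_num),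
    fun u hu => ?_⟩
  have h1 : ‖u‖ ≤ 2 * (r / 4) := (plane_norm_le hu).trans (by gcongr; exact min_le_right _ _)
  have h2 := hball (x := u) (by rw [dist_zero_right]; linarith)
  rw [Real.dist_eq] at h2
  linarith [(abs_lt.1 h2).1]

end IsSpatialKernel

/-- Beyond `g` the scaled kernel attains its minimum `0`, so its derivative vanishes there,
including at the boundary point. -/
theorem IsScoreKernel.isOddKernel {L : ℝ → ℝ} (hL : IsScoreKernel L) {g : ℝ} (hg : 0 < g) :
    IsOddKernel g fun v => deriv L (v / g) := by
  have hodd : ∀ v, deriv L (-v) = -deriv L v := by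
    intro v
    have h : (fun v => L (-v)) = L := funext hL.symmetric
    have h1 := deriv_comp_neg L v
    rw [h] at h1
    linarith
  refine ⟨?_, fun v => by rw [neg_div, hodd], fun v hv => ?_, fun v hv => ?_⟩
  · have h1 : ContDiff ℝ 1 (deriv L) := by
      have := hL.contDiff
      rw [show (2 : WithTop ℕ∞) = 1 + 1 from by norm_num, contDiff_succ_iff_deriv] at this
      exact this.2.2
    exact h1.comp (contDiff_id.div_const g)
  · have h1 := hL.deriv_pos (-(v / g)) ⟨by
      have := (div_lt_one hg).2 hv.2
      linarith, by
      have := div_pos hv.1 hg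
      linarith⟩
    rw [hodd] at h1
    linarith
  · have h1 : 1 ≤ v / g := (one_le_div hg).2 hv
    have hmin : IsLocalMin L (v / g) := Eventually.of_forall fun z => by
      rw [hL.eq_zero (v / g) fun h => absurd h.2 (not_lt.2 h1)]
      exact hL.nonneg z
    exact hmin.deriv_eq_zero

/-! ### The score function -/

section Score

variable {K : Plane → ℝ} {L : ℝ → ℝ} {g h : ℝ} {n : ℕ} {x : Plane} {R : Finset (Fin n × Fin n)}
  {Y : Fin n × Fin n → ℝ}

theorem hasDerivAt_scoreFunction (hL : Differentiable ℝ L) (y : ℝ) :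
    HasDerivAt (scoreFunction K L g h n x R Y)
      (1 / ((n : ℝ) ^ 2 * h ^ 2 * g ^ 2) *
        ∑ p ∈ R, K (h⁻¹ • (x - designPoint n p)) * deriv L ((y - Y p) / g)) y := by
  have h1 : ∀ p, HasDerivAt (fun y => (1 / h ^ 2 * K (h⁻¹ • (x - designPoint n p))) *
      (1 / g * L ((y - Y p) / g))) ((1 / h ^ 2 * K (h⁻¹ • (x - designPoint n p))) *
      (1 / g * (deriv L ((y - Y p) / g) * (1 / g)))) y := fun p =>
    (((hL _).hasDerivAt.comp y (((hasDerivAt_id y).sub_const (Y p)).div_const g)).const_mul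
      _).const_mul _
  have h2 := (HasDerivAt.fun_sum (u := R) fun p _ => h1 p).const_mul (1 / (n : ℝ) ^ 2)
  refine h2.congr_deriv ?_
  rw [Finset.mul_sum, Finset.mul_sum]
  refine Finset.sum_congr rfl fun p _ => ?_
  simp only [one_div, mul_inv, ← inv_pow]
  ring

theorem scoreFunction_nonneg (hK : IsSpatialKernel K) (hL : IsScoreKernel L) (hg : 0 < g) (y : ℝ) :
    0 ≤ scoreFunction K L g h n x R Y y := by
  refine mul_nonneg (by positivity) (Finset.sum_nonneg fun p _ => ?_)
  have := hK.nonneg' (h⁻¹ • (x - designPoint n p))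
  have := hL.nonneg ((y - Y p) / g)
  positivity

theorem exists_pos_of_scoreFunction_pos (hK : IsSpatialKernel K) (hL : IsScoreKernel L)
    (hg : 0 < g) {y : ℝ} (hy : 0 < scoreFunction K L g h n x R Y y) :
    ∃ p ∈ R, 0 < K (h⁻¹ • (x - designPoint n p)) ∧ |y - Y p| < g := by
  by_contra! hcon
  refine hy.ne' (mul_eq_zero_of_right _ (Finset.sum_eq_zero fun p hp => ?_))
  rcases (hK.nonneg' (h⁻¹ • (x - designPoint n p))).eq_or_lt with h0 | h0
  · rw [← h0]; ring
  · have h1 := hcon p hp h0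
    have h2 : L ((y - Y p) / g) = 0 := hL.eq_zero _ fun h3 => by
      have h4 := abs_lt.2 h3
      rw [abs_div, abs_of_pos hg, div_lt_one hg] at h4
      linarith
    rw [h2]; ring

end Score

/-- If the derivative of the score function has the correct signs around `m`, then all values of
the TM-smoother are close to `m`. -/
theorem exists_isTMValue_and_near {K : Plane → ℝ} (hK : IsSpatialKernel K) {L : ℝ → ℝ}
    (hL : IsScoreKernel L) {g h l : ℝ} (hg : 0 < g) (hh : 0 < h) (hl : l ∈ Ioo (0 : ℝ) (1 / 2))
    {n : ℕ} (hn : 0 < n) {x : Plane} {Y : Fin n × Fin n → ℝ} (hJ : (window h n x).Nonempty)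
    {m s t η W : ℝ} (hη : 0 < η) (hs : s ≤ -η) (ht : η ≤ t) (hW : 0 < W)
    (hsigns : ∀ (c ρ : ℝ) (S : Finset (Fin n × Fin n)),
      IsTrimmedMean (window h n x) (fun p => Y p - m) l c ρ S → (c - ρ < -η ∧ η < c + ρ) ∧
      (∀ y ∈ Icc s (-η), c - ρ ≤ y → 0 < ∑ p ∈ window h n x with |Y p - m - c| ≤ ρ,
        K (h⁻¹ • (x - designPoint n p)) / W * deriv L ((y - (Y p - m)) / g)) ∧
      (∀ y ∈ Icc η t, y ≤ c + ρ → ∑ p ∈ window h n x with |Y p - m - c| ≤ ρ,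
        K (h⁻¹ • (x - designPoint n p)) / W * deriv L ((y - (Y p - m)) / g) < 0))
    {p₀ : Fin n × Fin n} (hp₀ : IsCentre n x p₀) (hYp₀ : Y p₀ - m ∈ Icc s t) :
    (∃ v, IsTMValue K L g h l n x Y v) ∧ ∀ v, IsTMValue K L g h l n x Y v → |v - m| ≤ 3 * η := by
  have hk := hL.isOddKernel hg
  have hLd : Differentiable ℝ L := hL.contDiff.differentiable (by norm_num)
  have hn' : (0 : ℝ) < n := by exact_mod_cast hn
  -- Every LTS value must be treated since the selection is free, and nonemptiness is needed since
  -- `IsTMSmoother` says nothing where no value exists.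
  have main : ∀ c, IsLTSValue h l n x Y c →
      (admissibleModes (scoreFunction K L g h n x (retained h l n x Y c) Y) (Y p₀)).Nonempty ∧
      ∀ v ∈ closure (admissibleModes (scoreFunction K L g h n x (retained h l n x Y c) Y) (Y p₀)),
        (∀ w ∈ closure (admissibleModes (scoreFunction K L g h n x (retained h l n x Y c) Y)
          (Y p₀)), |v - Y p₀| ≤ |w - Y p₀|) → |v - m| ≤ 3 * η := by
    intro c hc
    obtain ⟨ρ, hρ, hR, S, hSJ, hSc, hSle, hSge, hSsum⟩ := hc.exists_mean Y hl hJ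
    have hsub : ∀ p, Y p - m - (c - m) = Y p - c := fun p => by ring
    obtain ⟨⟨h1, h2⟩, h3, h4⟩ := hsigns (c - m) ρ S
      ⟨hρ, hSJ, hSc, by simpa only [hsub] using hSle, by simpa only [hsub] using hSge,
        by simpa only [hsub] using hSsum⟩
    simp only [hsub] at h3 h4
    rw [hR]
    set R := (window h n x).filter fun p => |Y p - c| ≤ ρ with hRdef
    set H := scoreFunction K L g h n x R Y with hH
    set A := 1 / ((n : ℝ) ^ 2 * h ^ 2 * g ^ 2) with hA
    have hA0 : 0 < A := by positivity
    have hderiv : ∀ y, deriv H y = A * ∑ p ∈ R, K (h⁻¹ • (x - designPoint n p)) *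
        deriv L ((y - Y p) / g) := fun y => (hasDerivAt_scoreFunction hLd y).deriv
    -- Shifting by `m` and normalizing by `W` only multiplies the derivative by a positive constant,
    -- so its signs are those of the weighted empirical integral.
    have hscale : ∀ y, deriv H y = A * W * ∑ p ∈ R, K (h⁻¹ • (x - designPoint n p)) / W *
        deriv L ((y - m - (Y p - m)) / g) := fun y => by
      rw [hderiv, mul_assoc, Finset.mul_sum (a := W)]
      congr 1
      refine Finset.sum_congr rfl fun p _ => ?_
      rw [show y - m - (Y p - m) = y - Y p by ring]
      field_simp
    have hRmem : ∀ p ∈ R, c - ρ ≤ Y p ∧ Y p ≤ c + ρ := fun p hp => by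
      have := abs_le.1 (Finset.mem_filter.1 hp).2
      constructor <;> linarith [this.1, this.2]
    have hkpos : ∀ v, -g < v → v < 0 → 0 < deriv L (v / g) := fun v hv1 hv2 => by
      have h5 := hk.neg (-v) ⟨by linarith, by linarith⟩
      rw [hk.odd v] at h5
      linarith
    have hknn : ∀ v < 0, 0 ≤ deriv L (v / g) := fun v hv => by
      rcases le_or_gt v (-g) with h5 | h5
      · exact (hk.eq_zero_of_le_neg h5).ge
      · exact (hkpos v h5 hv).le
    have hknp : ∀ v > 0, deriv L (v / g) ≤ 0 := fun v hv => by
      have h5 := hknn (-v) (by linarith)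
      rw [hk.odd v] at h5
      linarith
    refine admissibleModes_near (m := m) (s := m + s) (t := m + t) (a := c - ρ) (b := c + ρ)
      (fun y => (hasDerivAt_scoreFunction hLd y).differentiableAt)
      (scoreFunction_nonneg hK hL hg) hη (by linarith) (by linarith) (by linarith) (by linarith)
      (fun y hy => ?_) (fun y hy => ?_) (fun y hy hay => ?_) (fun y hy hyb => ?_)
      ⟨by linarith [hYp₀.1], by linarith [hYp₀.2]⟩
    -- To the left of `c - ρ` all retained observations lie to the right of `y`, so every term is
    -- nonnegative, and one is positive if the score is.
    · have hterm : ∀ p ∈ R, 0 ≤ K (h⁻¹ • (x - designPoint n p)) * deriv L ((y - Y p) / g) :=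
        fun p hp => mul_nonneg (hK.nonneg' _) (hknn _ (by linarith [(hRmem p hp).1]))
      rw [hderiv]
      refine ⟨mul_nonneg hA0.le (Finset.sum_nonneg hterm), fun hpos => mul_pos hA0 ?_⟩
      obtain ⟨p, hp, hKp, hyp⟩ := exists_pos_of_scoreFunction_pos hK hL hg hpos
      exact Finset.sum_pos' hterm ⟨p, hp, mul_pos hKp
        (hkpos _ (abs_lt.1 hyp).1 (by linarith [(hRmem p hp).1]))⟩
    · have hterm : ∀ p ∈ R, K (h⁻¹ • (x - designPoint n p)) * deriv L ((y - Y p) / g) ≤ 0 :=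
        fun p hp => mul_nonpos_of_nonneg_of_nonpos (hK.nonneg' _)
          (hknp _ (by linarith [(hRmem p hp).2]))
      rw [hderiv]
      refine ⟨mul_nonpos_of_nonneg_of_nonpos hA0.le (Finset.sum_nonpos hterm),
        fun hpos => mul_neg_of_pos_of_neg hA0 ?_⟩
      obtain ⟨p, hp, hKp, hyp⟩ := exists_pos_of_scoreFunction_pos hK hL hg hpos
      exact Finset.sum_neg' hterm ⟨p, hp, mul_neg_of_pos_of_neg hKp
        (hk.neg _ ⟨by linarith [(hRmem p hp).2], (abs_lt.1 hyp).2⟩)⟩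
    · rw [hscale]
      exact mul_pos (by positivity) (h3 (y - m) ⟨by linarith [hy.1], by linarith [hy.2]⟩
        (by linarith))
    · rw [hscale]
      exact mul_neg_of_pos_of_neg (by positivity) (h4 (y - m)
        ⟨by linarith [hy.1], by linarith [hy.2]⟩ (by linarith))
  constructor
  · obtain ⟨c, hc⟩ := exists_isLTSValue Y hl hJ
    exact exists_isTMValue hp₀ hc (main c hc).1
  · rintro v ⟨q, c, hq, hc, hv, hmin⟩
    obtain rfl := hq.unique hp₀
    exact (main c hc).2 v hv hmin

/-! ### The Lévy distance -/

theorem levyDist_bddBelow (P Q : Measure ℝ) [IsProbabilityMeasure P] [IsProbabilityMeasure Q] :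
    BddBelow {ε : ℝ | ∀ y : ℝ, P.real (Iic (y - ε)) - ε ≤ Q.real (Iic y) ∧
      Q.real (Iic y) ≤ P.real (Iic (y + ε)) + ε} := by
  refine ⟨-1, fun ε hε => ?_⟩
  have h1 := (hε 0).1
  have h2 : Q.real (Iic 0) ≤ 1 := measureReal_le_one
  have h3 := measureReal_nonneg (μ := P) (s := Iic (0 - ε))
  linarith

theorem LevyClose.mono {P Q : Measure ℝ} [IsProbabilityMeasure P] {e e' : ℝ} (h : LevyClose P Q e)
    (hee : e ≤ e') : LevyClose P Q e' := fun y => by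
  have h1 : P.real (Iic (y - e')) ≤ P.real (Iic (y - e)) :=
    measureReal_mono (Iic_subset_Iic.2 (by linarith))
  have h2 : P.real (Iic (y + e)) ≤ P.real (Iic (y + e')) :=
    measureReal_mono (Iic_subset_Iic.2 (by linarith))
  constructor <;> linarith [(h y).1, (h y).2]

theorem levyClose_self (P : Measure ℝ) [IsProbabilityMeasure P] {e : ℝ} (he : 0 ≤ e) :
    LevyClose P P e :=
  LevyClose.mono (e := 0) (fun y => by simp) he

theorem levyClose_of_levyDist_lt {P Q : Measure ℝ} [IsProbabilityMeasure P]
    [IsProbabilityMeasure Q] {e : ℝ} (h : levyDist P Q < e) : LevyClose P Q e := by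
  have hne : {ε : ℝ | ∀ y : ℝ, P.real (Iic (y - ε)) - ε ≤ Q.real (Iic y) ∧
      Q.real (Iic y) ≤ P.real (Iic (y + ε)) + ε}.Nonempty := by
    refine ⟨1, fun y => ⟨?_, ?_⟩⟩
    · have h1 : P.real (Iic (y - 1)) ≤ 1 := measureReal_le_one
      have h2 := measureReal_nonneg (μ := Q) (s := Iic y)
      linarith
    · have h1 : Q.real (Iic y) ≤ 1 := measureReal_le_one
      have h2 := measureReal_nonneg (μ := P) (s := Iic (y + 1))
      linarith
  obtain ⟨ε, hε, hlt⟩ := exists_lt_of_csInf_lt hne h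
  exact LevyClose.mono hε hlt.le

/-- Both distribution functions climb from at most `e` to at least `1 - e` within `[m - r, m + r]`;
a horizontal shift by `e ≥ 2 * r` jumps over this interval. -/
theorem levyDist_le_of_concentrated {A B : Measure ℝ} [IsProbabilityMeasure A]
    [IsProbabilityMeasure B] {m r e : ℝ} (hre : 2 * r ≤ e)
    (hA : A.real {z | r < |z - m|} ≤ e) (hB : B.real {z | r < |z - m|} ≤ e) :
    levyDist A B ≤ e := by
  have key : ∀ M : Measure ℝ, IsProbabilityMeasure M → M.real {z | r < |z - m|} ≤ e → ∀ y,
      (y < m - r → M.real (Iic y) ≤ e) ∧ (m + r ≤ y → 1 - e ≤ M.real (Iic y)) := by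
    intro M _ hM y
    constructor
    · intro hy
      refine (measureReal_mono fun z hz => ?_).trans hM
      have hz' : z ≤ y := hz
      exact show r < |z - m| from lt_abs.2 (Or.inr (by linarith))
    · intro hy
      have h1 : M.real (Iic y)ᶜ ≤ e := (measureReal_mono fun z hz => by
        have hz' : y < z := not_le.1 hz
        exact show r < |z - m| from lt_abs.2 (Or.inl (by linarith))).trans hM
      rw [probReal_compl_eq_one_sub measurableSet_Iic] at h1
      linarith
  refine csInf_le (levyDist_bddBelow A B) fun y => ?_
  have hA1 : ∀ y, A.real (Iic y) ≤ 1 := fun y => measureReal_le_one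
  have hB1 : ∀ y, B.real (Iic y) ≤ 1 := fun y => measureReal_le_one
  have hA0 : ∀ y, 0 ≤ A.real (Iic y) := fun y => measureReal_nonneg
  have hB0 : ∀ y, 0 ≤ B.real (Iic y) := fun y => measureReal_nonneg
  constructor
  · rcases lt_or_ge y (m + r) with h | h
    · have := (key A inferInstance hA (y - e)).1 (by linarith)
      linarith [hB0 y]
    · have := (key B inferInstance hB y).2 h
      linarith [hA1 (y - e)]
  · rcases lt_or_ge y (m - r) with h | h
    · have := (key B inferInstance hB y).1 h
      linarith [hA0 (y + e)]
    · have := (key A inferInstance hA (y + e)).2 (by linarith)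
      linarith [hB1 y]

/-! ### The regression function -/

theorem continuousAt_regressionFunction {μ : Plane → ℝ} {d : ℝ} {D : Set Plane}
    (hm : IsImageModel μ d D) {x : Plane} (hx : x ∈ openUnitSquare \ frontier D) :
    ContinuousAt (regressionFunction μ d D) x := by
  classical
  have hsq : unitSquare ∈ 𝓝 x := by
    have hopen : IsOpen openUnitSquare := by
      have : openUnitSquare = ⋂ k : Fin 2, (fun x : Plane => x k) ⁻¹' Ioo 0 1 := by
        ext; simp [openUnitSquare]
      rw [this]
      exact isOpen_iInter_of_finite fun k => isOpen_Ioo.preimage (by fun_prop)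
    exact Filter.mem_of_superset (hopen.mem_nhds hx.1) fun z hz k => Ioo_subset_Icc_self (hz k)
  have hμ : ContinuousAt μ x := hm.continuousOn.continuousAt hsq
  by_cases hxD : x ∈ D
  · have hint : D ∈ 𝓝 x := by
      rw [← mem_interior_iff_mem_nhds]
      by_contra hcon
      exact hx.2 ⟨subset_closure hxD, hcon⟩
    refine (hμ.add_const d).congr ?_
    filter_upwards [hint] with z hz
    simp [regressionFunction, hz]
  · refine hμ.congr ?_
    filter_upwards [hm.isClosed.isOpen_compl.mem_nhds hxD] with z hz
    have hz' : z ∉ D := hz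
    simp [regressionFunction, hz']

/-! ### The error law -/

theorem IsUnimodalErrorLaw.exists_density {g : ℝ} {P : Measure ℝ} [IsProbabilityMeasure P]
    (hP : IsUnimodalErrorLaw g P) : ∃ f I, IsUnimodalDensity g f I ∧
      P = volume.withDensity fun y => ENNReal.ofReal (f y) := by
  obtain ⟨f, I, hfm, hf0, hPf, hI, h0, hfI, hsymm, hanti, hmono⟩ := hP
  refine ⟨f, I, ⟨hfm, hf0, ?_, hI, h0, hfI, hsymm, hanti, hmono⟩, hPf⟩
  refine ⟨hfm.aestronglyMeasurable, ?_⟩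
  rw [hasFiniteIntegral_iff_ofReal (ae_of_all _ hf0)]
  have := measure_lt_top P univ
  rwa [hPf, withDensity_apply _ MeasurableSet.univ, setLIntegral_univ] at this

namespace IsUnimodalDensity

variable {g : ℝ} {f : ℝ → ℝ} {I : Set ℝ} (hf : IsUnimodalDensity g f I)
include hf

/-- If only a positive point of `I` is known, the density is positive at a small positive point, and
symmetry on `[-g, g]` carries this to the left. -/
theorem exists_neg_mem (hg : 0 < g) {y : ℝ} (hy : y ∈ I) (hy0 : y ≠ 0) : ∃ z ∈ I, z < 0 := by
  rcases lt_or_gt_of_ne hy0 with h | h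
  · exact ⟨y, hy, h⟩
  have hm : 0 < min y g / 2 := by positivity
  have hmy : min y g / 2 < y := by linarith [min_le_left y g]
  have hlt := hf.strictAntiOn
    ⟨hm, hf.ordConnected.out hf.zero_mem hy ⟨hm.le, hmy.le⟩⟩ ⟨h, hy⟩ hmy
  rw [← hf.symm (min y g / 2) ⟨by linarith, by linarith [min_le_right y g]⟩] at hlt
  refine ⟨-(min y g / 2), ?_, by linarith⟩
  by_contra hcon
  rw [hf.eq_zero _ hcon] at hlt
  linarith [hf.nonneg y]

variable {P : Measure ℝ} (hP : P = volume.withDensity fun y => ENNReal.ofReal (f y))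
include hP

theorem exists_mem_of_pos {A : Set ℝ} (hA : MeasurableSet A) (h : 0 < P.real A) :
    ∃ y ∈ A, y ∈ I := by
  by_contra! hcon
  have : P A = 0 := by
    rw [hP, withDensity_apply _ hA, setLIntegral_congr_fun hA (g := fun _ => 0)
      fun y hy => by rw [hf.eq_zero y (hcon y hy), ENNReal.ofReal_zero]]
    simp
  simp [measureReal_def, this] at h

variable [IsProbabilityMeasure P]

theorem exists_neg_pos_mem (hg : 0 < g) : (∃ z ∈ I, z < 0) ∧ ∃ z ∈ I, 0 < z := by
  have hnull : NullSingletonClass P := by rw [hP]; infer_instance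
  obtain ⟨y, hy0, hy⟩ := hf.exists_mem_of_pos hP (measurableSet_singleton (0 : ℝ)).compl
    (by rw [probReal_compl_eq_one_sub (measurableSet_singleton _)]; simp [measureReal_def])
  refine ⟨hf.exists_neg_mem hg hy hy0, ?_⟩
  obtain ⟨z, hz, hz0⟩ := hf.reflect.exists_neg_mem hg (y := -y) (by simpa using hy)
    (by simpa using hy0)
  exact ⟨-z, hz, by linarith⟩

/-- The central part of the support carries almost the whole mass. -/
theorem exists_range (hg : 0 < g) {α : ℝ} (hα : 0 < α) :
    ∃ s ∈ I, ∃ t ∈ I, s < 0 ∧ 0 < t ∧ P.real (Iic s) ≤ α ∧ 1 - α ≤ P.real (Iic t) := by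
  have hnull : NullSingletonClass P := by rw [hP]; infer_instance
  obtain ⟨⟨z, hz, hz0⟩, ⟨z', hz', hz'0⟩⟩ := hf.exists_neg_pos_mem hP hg
  have hmono := ProbabilityTheory.monotone_cdf P
  have hcont := continuous_cdf_of_nullSingleton (P := P)
  have hcdf := ProbabilityTheory.cdf_eq_real P
  have hs : ∃ s ∈ I, s < 0 ∧ P.real (Iic s) ≤ α := by
    rcases le_or_gt (P.real (Iic z)) α with h | h
    · exact ⟨z, hz, hz0, h⟩
    obtain ⟨s, hs⟩ := mem_range_of_exists_le_of_exists_ge hcont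
      ((ProbabilityTheory.tendsto_cdf_atBot P).eventually_le_const hα).exists
      ⟨z, by rw [hcdf]; exact h.le⟩
    have hsz : s < z := by
      apply hmono.reflect_lt
      rw [hs, hcdf]; exact h
    rw [hcdf] at hs
    obtain ⟨y, hys, hyI⟩ := hf.exists_mem_of_pos hP measurableSet_Iic (by rw [hs]; exact hα)
    exact ⟨s, hf.ordConnected.out hyI hz ⟨hys, hsz.le⟩, by linarith, hs.le⟩
  have ht : ∃ t ∈ I, 0 < t ∧ 1 - α ≤ P.real (Iic t) := by
    rcases le_or_gt (1 - α) (P.real (Iic z')) with h | h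
    · exact ⟨z', hz', hz'0, h⟩
    obtain ⟨t, ht⟩ := mem_range_of_exists_le_of_exists_ge hcont ⟨z', by rw [hcdf]; exact h.le⟩
      ((ProbabilityTheory.tendsto_cdf_atTop P).eventually_const_le
        (show 1 - α < 1 by linarith)).exists
    have hzt : z' < t := by
      apply hmono.reflect_lt
      rw [ht, hcdf]; exact h
    rw [hcdf] at ht
    obtain ⟨y, hyt, hyI⟩ := hf.exists_mem_of_pos hP (measurableSet_Iic (a := t)).compl (by
      rw [probReal_compl_eq_one_sub measurableSet_Iic, ht]; linarith)
    exact ⟨t, hf.ordConnected.out hz' hyI ⟨hzt.le, (not_le.1 (show ¬ y ≤ t from hyt)).le⟩, by linarith, ht.ge⟩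
  obtain ⟨s, hsI, hs0, hs⟩ := hs
  obtain ⟨t, htI, ht0, ht⟩ := ht
  exact ⟨s, hsI, t, htI, hs0, ht0, hs, ht⟩

end IsUnimodalDensity

theorem eventually_measureReal_Icc_lt (P : Measure ℝ) [IsProbabilityMeasure P]
    [NullSingletonClass P] {a : ℝ} (ha : 0 < a) : ∀ᶠ η in 𝓝 (0 : ℝ), P.real (Icc (-η) η) < a := by
  have h : ContinuousAt (fun η : ℝ => ∫ _ in Icc (-η) η, (1 : ℝ) ∂P) 0 :=
    continuousAt_setIntegral_Icc continuous_neg continuous_id (φ := fun _ _ => (1 : ℝ))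
      (by fun_prop) (C := 1) (by simp) zero_le_one
  simp only [setIntegral_const, smul_eq_mul, mul_one] at h
  exact h.eventually_lt_const (by simpa [measureReal_def] using ha)

/-! ### Uniform concentration and conclusion -/

set_option maxHeartbeats 1000000 in
/-- With high probability, the TM-smoother is close to the regression function, uniformly over all
laws of the residuals in a Lévy ball around a unimodal law. -/
theorem exists_measure_tmSmoother_le {μ : Plane → ℝ} {d : ℝ} {D : Set Plane}
    (hm : IsImageModel μ d D) {K : Plane → ℝ} (hK : IsSpatialKernel K) {L : ℝ → ℝ}
    (hL : IsScoreKernel L) {h : ℕ → ℝ} (hh : IsBandwidth h) {g : ℝ} (hg : 0 < g) {l : ℝ}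
    (hl : l ∈ Ioo (0 : ℝ) (1 / 2)) {P : Measure ℝ} [IsProbabilityMeasure P]
    (hP : IsUnimodalErrorLaw g P) {x₀ : Plane} (hx₀ : x₀ ∈ openUnitSquare \ frontier D)
    {r α : ℝ} (hr : 0 < r) (hα : 0 < α) :
    ∃ e > 0, ∃ N : ℕ, ∀ Q : Measure ℝ, IsProbabilityMeasure Q → LevyClose P Q e → ∀ n ≥ N,
      ∀ T : (Fin n × Fin n → ℝ) → ℝ, IsTMSmoother K L g (h n) l n x₀ T →
        (Measure.pi fun _ : Fin n × Fin n => Q)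
          {ε | r < |T (fun p => regressionFunction μ d D (designPoint n p) + ε p) -
            regressionFunction μ d D x₀|} ≤ ENNReal.ofReal α := by
  classical
  obtain ⟨f, I, hf, hPf⟩ := hP.exists_density
  have hnull : NullSingletonClass P := by rw [hPf]; infer_instance
  set m := regressionFunction μ d D with hmdef
  set m₀ := m x₀ with hm₀
  obtain ⟨s, hs, t, ht, hs0, ht0, hsα, htα⟩ := hf.exists_range hPf hg (show 0 < α / 16 by positivity)
  obtain ⟨η, hη0, hηr, hηg, hηs, hηt, hηP⟩ : ∃ η : ℝ, 0 < η ∧ 3 * η < r ∧ η < g ∧ η < -s ∧ η < t ∧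
      P.real (Icc (-η) η) < 1 - l := by
    have h1 : ∀ᶠ η in 𝓝[>] (0 : ℝ), η < r / 3 ∧ η < g ∧ η < -s ∧ η < t ∧
        P.real (Icc (-η) η) < 1 - l := nhdsWithin_le_nhds
      ((eventually_lt_nhds (by positivity)).and ((eventually_lt_nhds hg).and
        ((eventually_lt_nhds (by linarith)).and ((eventually_lt_nhds ht0).and
        (eventually_measureReal_Icc_lt P (by linarith [hl.2]))))))
    obtain ⟨η, ⟨h2, h3⟩, h4⟩ := (h1.and self_mem_nhdsWithin).exists
    exact ⟨η, h4, by linarith, h3⟩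
  have hk := hL.isOddKernel hg
  obtain ⟨δ, hδ, hδsigns⟩ := hf.exists_delta hPf hg hk hl hs ht hη0 hηg hηP
  obtain ⟨τ, hτ, C, hC, hdev⟩ := exists_measure_not_cdfClose_le P hδ
  -- The margin `2 * τ₁` covers the difference between `m` at the central pixel and `m x₀` as well
  -- as the Lévy shift. Together with `e ≤ α / 8`, each tail of the starting value has probability
  -- at most `α / 4`.
  obtain ⟨τ₁, hτ₁, hsτ, htτ⟩ : ∃ τ₁ : ℝ, 0 < τ₁ ∧ P.real (Iic (s + 2 * τ₁)) < α / 8 ∧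
      1 - α / 8 < P.real (Iic (t - 2 * τ₁)) := by
    have hcont := continuous_cdf_of_nullSingleton (P := P)
    simp_rw [← ProbabilityTheory.cdf_eq_real] at hsα htα ⊢
    have h1 : ContinuousAt (fun τ => ProbabilityTheory.cdf P (s + 2 * τ)) 0 := by fun_prop
    have h2 : ContinuousAt (fun τ => ProbabilityTheory.cdf P (t - 2 * τ)) 0 := by fun_prop
    have h3 : ∀ᶠ τ in 𝓝[>] (0 : ℝ), ProbabilityTheory.cdf P (s + 2 * τ) < α / 8 ∧
        1 - α / 8 < ProbabilityTheory.cdf P (t - 2 * τ) := nhdsWithin_le_nhds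
      ((h1.eventually_lt_const (by simp only [mul_zero, add_zero]; linarith)).and
        (h2.eventually_const_lt (by simp only [mul_zero, sub_zero]; linarith)))
    obtain ⟨τ₁, h4, h5⟩ := (h3.and self_mem_nhdsWithin).exists
    exact ⟨τ₁, h5, h4⟩
  set e := min (min τ τ₁) (α / 8) with he
  have he0 : 0 < e := by positivity
  have heτ : e ≤ τ := (min_le_left _ _).trans (min_le_left _ _)
  have heτ₁ : e ≤ τ₁ := (min_le_left _ _).trans (min_le_right _ _)
  have heα : e ≤ α / 8 := min_le_right _ _
  obtain ⟨B, hB0, hB⟩ := hK.exists_le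
  obtain ⟨θ, hθ0, hθ1, hθ⟩ := hK.exists_ge
  have hK0 := hK.pos_zero
  -- The three thresholds make `1 / #J ≤ δ` and bound Chebyshev's estimate for the uniform weights
  -- and for the kernel weights, the latter being at most `B / W` with `W ≥ M * (K 0 / 2)`.
  obtain ⟨M, hM⟩ := exists_nat_gt (max (1 / δ) (max (8 * C / α) (8 * C * B / (α * (K 0 / 2)))))
  have hM1 : 1 / δ < M := (le_max_left _ _).trans_lt hM
  have hM2 : 8 * C / α < M := ((le_max_left _ _).trans (le_max_right _ _)).trans_lt hM
  have hM3 : 8 * C * B / (α * (K 0 / 2)) < M :=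
    ((le_max_right _ _).trans (le_max_right _ _)).trans_lt hM
  have hM0 : (0 : ℝ) < M := lt_trans (by positivity) hM1
  obtain ⟨ω, hω0, hω⟩ := Metric.continuousAt_iff.1 (continuousAt_regressionFunction hm hx₀) e he0
  have hev : ∀ᶠ n in atTop, M ≤ (window (θ * h n) n x₀).card ∧ 2 * h n < ω ∧ 0 < n :=
    (eventually_le_card_window hh hx₀.1 hθ0 M).and
      (((hh.tendsto_zero.eventually_lt_const (show 0 < ω / 2 by positivity)).mono
        fun n hn => by linarith).and (eventually_gt_atTop 0))
  obtain ⟨N, hN⟩ := eventually_atTop.1 hev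
  refine ⟨e, he0, N, fun Q hQ hPQ n hn T hT => ?_⟩
  obtain ⟨hcard, hhω, hn0⟩ := hN n hn
  have hhn := hh.pos n
  set J := window (h n) n x₀ with hJdef
  set J' := window (θ * h n) n x₀ with hJ'def
  have hJ'J : J' ⊆ J := fun p hp => Finset.mem_filter.2 ⟨Finset.mem_univ _, fun k =>
    ((Finset.mem_filter.1 hp).2 k).trans (by nlinarith)⟩
  have hcard' : (M : ℝ) ≤ J'.card := by exact_mod_cast hcard
  have hcardJ : (M : ℝ) ≤ J.card := hcard'.trans (by exact_mod_cast Finset.card_le_card hJ'J)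
  have hJ : J.Nonempty := Finset.card_pos.1 (by exact_mod_cast hM0.trans_le hcardJ)
  have hJpos : (0 : ℝ) < J.card := hM0.trans_le hcardJ
  let κ : Fin n × Fin n → ℝ := fun p => K ((h n)⁻¹ • (x₀ - designPoint n p))
  have hκ0 : ∀ p, 0 ≤ κ p := fun p => hK.nonneg' _
  set W := ∑ p ∈ J, κ p with hW
  have hWM : M * (K 0 / 2) ≤ W := by
    calc M * (K 0 / 2) ≤ J'.card * (K 0 / 2) := by gcongr
      _ = ∑ p ∈ J', K 0 / 2 := by rw [Finset.sum_const, nsmul_eq_mul]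
      _ ≤ ∑ p ∈ J', κ p := Finset.sum_le_sum fun p hp => hθ _ fun k => by
          have h1 := (Finset.mem_filter.1 hp).2 k
          rw [PiLp.smul_apply, PiLp.sub_apply, smul_eq_mul, abs_mul, abs_of_pos (inv_pos.2 hhn),
            inv_mul_le_iff₀ hhn, mul_comm]
          exact h1
      _ ≤ W := Finset.sum_le_sum_of_subset_of_nonneg hJ'J fun p _ _ => hκ0 p
  have hW0 : 0 < W := lt_of_lt_of_le (by positivity) hWM
  have hdist : ∀ p ∈ J, ‖x₀ - designPoint n p‖ ≤ 2 * h n := fun p hp =>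
    plane_norm_le fun k => (Finset.mem_filter.1 hp).2 k
  obtain ⟨p₀, hp₀⟩ := exists_isCentre hn0 x₀
  have hdist₀ : ‖x₀ - designPoint n p₀‖ ≤ 2 * h n := by
    obtain ⟨q, hq⟩ := hJ
    exact (hp₀.1 q).trans (hdist q hq)
  have hmclose : ∀ p, ‖x₀ - designPoint n p‖ ≤ 2 * h n → |m (designPoint n p) - m₀| ≤ e :=
    fun p hp => by
      have h1 := hω (x := designPoint n p) (by rw [dist_comm, dist_eq_norm]; linarith)
      rw [Real.dist_eq] at h1
      exact h1.le
  let Y : (Fin n × Fin n → ℝ) → Fin n × Fin n → ℝ := fun ε p => m (designPoint n p) + ε p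
  have hZε : ∀ ε : Fin n × Fin n → ℝ, ∀ p ∈ J, |Y ε p - m₀ - ε p| ≤ τ := fun ε p hp => by
    rw [show Y ε p - m₀ - ε p = m (designPoint n p) - m₀ by simp only [Y]; ring]
    exact (hmclose p (hdist p hp)).trans heτ
  set π := Measure.pi fun _ : Fin n × Fin n => Q with hπ
  -- Quantifying over all nearby `Z` lets the shifted observations `Y - m₀` be inserted afterwards.
  -- Only outer measure and monotonicity are used, so measurability of this set plays no role.
  let bad : (Fin n × Fin n → ℝ) → Set (Fin n × Fin n → ℝ) := fun w => {ε | ∃ Z,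
    (∀ p ∈ J, |Z p - ε p| ≤ τ) ∧ ¬ CDFClose P (weightedEmpirical J w Z) δ}
  have hsub : {ε | r < |T (Y ε) - m₀|} ⊆ ((bad fun _ => 1 / (J.card : ℝ)) ∪ bad fun p => κ p / W) ∪
      ((Function.eval p₀ ⁻¹' Iic (s + τ₁)) ∪ (Function.eval p₀ ⁻¹' Ioi (t - τ₁))) := by
    intro ε hε
    by_contra hcon
    simp only [mem_union, not_or] at hcon
    obtain ⟨⟨hb1, hb2⟩, hb3, hb4⟩ := hcon
    have hc1 : CDFClose P (weightedEmpirical J (fun _ => 1 / (J.card : ℝ)) fun p => Y ε p - m₀) δ := by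
      by_contra hc
      exact hb1 ⟨_, hZε ε, hc⟩
    have hc2 : CDFClose P (weightedEmpirical J (fun p => κ p / W) fun p => Y ε p - m₀) δ := by
      by_contra hc
      exact hb2 ⟨_, hZε ε, hc⟩
    have hb3' : s + τ₁ < ε p₀ := not_le.1 (show ¬ ε p₀ ≤ s + τ₁ from hb3)
    have hb4' : ε p₀ ≤ t - τ₁ := not_lt.1 (show ¬ t - τ₁ < ε p₀ from hb4)
    have hm' := abs_le.1 ((hmclose p₀ hdist₀).trans heτ₁)
    have hδJ : 1 / (J.card : ℝ) ≤ δ := by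
      rw [div_lt_iff₀ hδ] at hM1
      rw [div_le_iff₀ hJpos]
      have h1 : δ * M ≤ δ * J.card := mul_le_mul_of_nonneg_left hcardJ hδ.le
      linarith
    obtain ⟨hex, hnear⟩ := exists_isTMValue_and_near hK hL hg hhn hl hn0 (Y := Y ε) hJ (m := m₀)
      (s := s) (t := t) hη0 (by linarith) hηt.le hW0
      (fun c ρ S hS => hδsigns _ J (fun p => Y ε p - m₀) (fun p => κ p / W) hJ hδJ
        (fun p _ => div_nonneg (hκ0 p) hW0.le) hc1 hc2 c ρ S hS) hp₀
      ⟨by simp only [Y]; linarith [hm'.1], by simp only [Y]; linarith [hm'.2]⟩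
    have h1 := hnear _ (hT (Y ε) hex)
    have h2 : r < |T (Y ε) - m₀| := hε
    linarith
  have hb1 : π (bad fun _ => 1 / (J.card : ℝ)) ≤ ENNReal.ofReal (α / 4) := by
    refine (hdev Q hQ (hPQ.mono heτ) _ J _ (1 / (J.card : ℝ)) (fun _ _ => by positivity)
      (by rw [Finset.sum_const, nsmul_eq_mul, mul_one_div_cancel hJpos.ne'])
      fun _ _ => le_rfl).trans (ENNReal.ofReal_le_ofReal ?_)
    rw [mul_one_div, div_le_iff₀ hJpos]
    rw [div_lt_iff₀ hα] at hM2
    have h1 : α * M ≤ α * J.card := mul_le_mul_of_nonneg_left hcardJ hα.le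
    linarith
  have hb2 : π (bad fun p => κ p / W) ≤ ENNReal.ofReal (α / 4) := by
    refine (hdev Q hQ (hPQ.mono heτ) _ J _ (B / W) (fun p _ => div_nonneg (hκ0 p) hW0.le)
      (by rw [← Finset.sum_div, div_self hW0.ne'])
      fun p _ => by gcongr; exact hB _).trans (ENNReal.ofReal_le_ofReal ?_)
    rw [mul_div_assoc', div_le_iff₀ hW0]
    rw [div_lt_iff₀ (by positivity)] at hM3
    have h1 : α * (M * (K 0 / 2)) ≤ α * W := mul_le_mul_of_nonneg_left hWM hα.le
    linarith [mul_nonneg hC hB0.le]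
  have heval : ∀ A : Set ℝ, MeasurableSet A →
      π (Function.eval p₀ ⁻¹' A) = ENNReal.ofReal (Q.real A) := fun A hA => by
    rw [hπ, (measurePreserving_eval (fun _ : Fin n × Fin n => Q) p₀).measure_preimage
      hA.nullMeasurableSet, ofReal_measureReal]
  have hmonoP : ∀ {u v : ℝ}, u ≤ v → P.real (Iic u) ≤ P.real (Iic v) := fun h =>
    measureReal_mono (Iic_subset_Iic.2 h)
  have hb3 : π (Function.eval p₀ ⁻¹' Iic (s + τ₁)) ≤ ENNReal.ofReal (α / 4) := by
    rw [heval _ measurableSet_Iic]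
    refine ENNReal.ofReal_le_ofReal ?_
    have h1 := (hPQ (s + τ₁)).2
    have h2 := hmonoP (show s + τ₁ + e ≤ s + 2 * τ₁ by linarith)
    linarith
  have hb4 : π (Function.eval p₀ ⁻¹' Ioi (t - τ₁)) ≤ ENNReal.ofReal (α / 4) := by
    rw [heval _ measurableSet_Ioi]
    refine ENNReal.ofReal_le_ofReal ?_
    rw [← compl_Iic, probReal_compl_eq_one_sub measurableSet_Iic]
    have h1 := (hPQ (t - τ₁)).1
    have h2 := hmonoP (show t - 2 * τ₁ ≤ t - τ₁ - e by linarith)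
    linarith
  calc π {ε | r < |T (Y ε) - m₀|} ≤ _ := measure_mono hsub
    _ ≤ (π (bad fun _ => 1 / (J.card : ℝ)) + π (bad fun p => κ p / W)) +
        (π (Function.eval p₀ ⁻¹' Iic (s + τ₁)) + π (Function.eval p₀ ⁻¹' Ioi (t - τ₁))) :=
      (measure_union_le _ _).trans (add_le_add (measure_union_le _ _) (measure_union_le _ _))
    _ ≤ (ENNReal.ofReal (α / 4) + ENNReal.ofReal (α / 4)) +
        (ENNReal.ofReal (α / 4) + ENNReal.ofReal (α / 4)) :=
      add_le_add (add_le_add hb1 hb2) (add_le_add hb3 hb4)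
    _ = ENNReal.ofReal α := by
      rw [← ENNReal.ofReal_add (by positivity) (by positivity),
        ← ENNReal.ofReal_add (by positivity) (by positivity)]
      congr 1
      ring

theorem theorem4
    (μ : Plane → ℝ) (d : ℝ) (D : Set Plane) (hm : IsImageModel μ d D)
    (K : Plane → ℝ) (hK : IsSpatialKernel K)
    (L : ℝ → ℝ) (hL : IsScoreKernel L)
    (h : ℕ → ℝ) (hh : IsBandwidth h)
    (g : ℝ) (hg : 0 < g) (l : ℝ) (hl : l ∈ Set.Ioo (0 : ℝ) (1 / 2))
    (P : Measure ℝ) [IsProbabilityMeasure P] (hP : IsUnimodalErrorLaw g P)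
    (x₀ : Plane) (hx₀ : x₀ ∈ openUnitSquare \ frontier D)
    (mTM : ∀ n : ℕ, (Fin n × Fin n → ℝ) → ℝ) (hmeas : ∀ n, Measurable (mTM n))
    (hmTM : ∀ n, IsTMSmoother K L g (h n) l n x₀ (mTM n)) :
    IsRobustForLargeSamples (regressionFunction μ d D) mTM P := by
  intro εstar hεstar
  obtain ⟨e, he, N, hN⟩ := exists_measure_tmSmoother_le hm hK hL hh hg hl hP hx₀
    (show 0 < εstar / 2 by positivity) hεstar
  -- Halving `e` turns a bound on the infimum `levyDist` into a strict one, so that radius `e` is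
  -- admissible without knowing that the infimum is attained.
  refine ⟨e / 2, by positivity, N, fun Q hQ hPQ n hn => ?_⟩
  have hmap : Measurable fun ε : Fin n × Fin n → ℝ =>
      mTM n fun p => regressionFunction μ d D (designPoint n p) + ε p :=
    (hmeas n).comp (measurable_pi_lambda _ fun p => (measurable_pi_apply p).const_add _)
  have hset : MeasurableSet {z : ℝ | εstar / 2 < |z - regressionFunction μ d D x₀|} :=
    measurableSet_lt measurable_const (by fun_prop)
  have key : ∀ Q : Measure ℝ, IsProbabilityMeasure Q → LevyClose P Q e →
      IsProbabilityMeasure (estimatorLaw (regressionFunction μ d D) n (mTM n) Q) ∧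
      (estimatorLaw (regressionFunction μ d D) n (mTM n) Q).real
        {z : ℝ | εstar / 2 < |z - regressionFunction μ d D x₀|} ≤ εstar := by
    intro Q hQ hPQ
    refine ⟨Measure.isProbabilityMeasure_map hmap.aemeasurable, ?_⟩
    rw [measureReal_def]
    refine ENNReal.toReal_le_of_le_ofReal hεstar.le ?_
    rw [estimatorLaw, Measure.map_apply hmap hset]
    exact hN Q hQ hPQ n hn (mTM n) (hmTM n)
  obtain ⟨hpP, hP'⟩ := key P inferInstance (levyClose_self P he.le)
  obtain ⟨hpQ, hQ'⟩ := key Q hQ (levyClose_of_levyDist_lt (by linarith))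
  exact levyDist_le_of_concentrated (by linarith) hP' hQ'
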